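/- Let $L$ be the class of continuous functions $a:\mathbb R\to[0,\infty)$ for which there is $x_0\in\mathbb R$ such that $a(x)=a(x_0)$ for $x\le x_0$ and $a$ increases to $+\infty$ on $[x_0,\infty)$. Write $a\in L_1$ if $a\in L$ and, for some $c>0$ and $R_0$, $a(x+y)\le a(x)+a(y)+c$ for all $x,y\ge R_0$; $a\in L_2$ if $a\in L$ and $a(x+O(1))=(1+o(1))a(x)$ as $x\to+\infty$; $a\in L_3$ if $a\in L$ and, for some $R_0$, $a(x+y)\le a(x)+a(y)$ for all $x,y\ge R_0$. For $a\in L$ let $a^{-1}$ be the inverse of $a$ on $[x_0,\infty)$ (if $a$ is not strictly increasing there, $a^{-1}(y)=\max\{x:a(x)\le y\}$). Let $\alpha\in L_1$, $\beta\in L_2$, $\gamma\in L_3$ satisfy, as $x\to+\infty$, $\alpha(\log^{[p]}x)=o(\beta(\log\gamma(x)))$ for every integer $p\ge2$ (where $\log^{[p]}$ is the $p$-fold iterate of $\log$), $\alpha(\log x)=o(\alpha(x))$, and $\alpha^{-1}(\kappa x)=o(\alpha^{-1}(x))$ for every $0\le\kappa<1$. Let $f\not\equiv0$ be a meromorphic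 function in the unit disc $\Delta=\{|z|<1\}$, with Nevanlinna characteristic $T(r,f)=m(r,f)+N(r,f)$, where $m(r,f)=\frac1{2\pi}\int_0^{2\pi}\log^+|f(re^{i\theta})|\,d\theta$ is the proximity function and $N(r,f)$ is the integrated counting function of the poles with multiplicity. Suppose that its $(\alpha(\log),\beta,\gamma)$-order $$\limsup_{r\to1^-}\frac{\alpha(\log^{[2]}T(r,f))}{\beta\left(\log\gamma\left(\frac1{1-r}\right)\right)}=\varrho$$ is finite (logarithms of $T(r,f)$ being replaced by $0$ where they are negative or undefined). Then for every integer $k\ge1$ and every $\varepsilon>0$ there is a measurable set $F\subset[0,1)$ of finite logarithmic measure, $\int_F\frac{dr}{1-r}<\infty$, such that $$m\left(r,\frac{f^{(k)}}{f}\right)=O\left(\exp\left\{\alpha^{-1}\left((\varrho+\varepsilon)\,\beta\left(\log\gamma\left(\tfrac1{1-r}\right)\right)\right)\right\}\right)\qquad(r\to1^-,\ r\notin F).$$ -/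

import Mathlib

open Set Filter Topology Asymptotics MeasureTheory

namespace UnitDisc

/-- The class `L`: continuous non-negative functions on the real line which are constant on some
half-line `(-∞, x₀]` and increase (not necessarily strictly) to `+∞` on `[x₀, +∞)`. -/
structure ClassL (a : ℝ → ℝ) : Prop where
  continuous : Continuous a
  nonneg : ∀ x, 0 ≤ a x
  exists_base : ∃ x₀ : ℝ, (∀ x ≤ x₀, a x = a x₀) ∧ MonotoneOn a (Ici x₀)
  tendsto_atTop : Tendsto a atTop atTop

/-- The class `L₁`: `a ∈ L` and `a (x + y) ≤ a x + a y + c` for all `x, y ≥ R₀`. -/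
structure ClassL1 (a : ℝ → ℝ) : Prop extends ClassL a where
  almost_subadditive : ∃ c > 0, ∃ R₀ : ℝ, ∀ x ≥ R₀, ∀ y ≥ R₀, a (x + y) ≤ a x + a y + c

/-- The class `L₂`: `a ∈ L` and `a (x + O(1)) = (1 + o(1)) a x` as `x → +∞`. -/
structure ClassL2 (a : ℝ → ℝ) : Prop extends ClassL a where
  equivalent_shift : ∀ h : ℝ → ℝ, h =O[atTop] (fun _ => (1 : ℝ)) →
    (fun x => a (x + h x)) ~[atTop] a

/-- The class `L₃`: `a ∈ L` and `a (x + y) ≤ a x + a y` for all `x, y ≥ R₀`. -/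
structure ClassL3 (a : ℝ → ℝ) : Prop extends ClassL a where
  subadditive : ∃ R₀ : ℝ, ∀ x ≥ R₀, ∀ y ≥ R₀, a (x + y) ≤ a x + a y

/-- The inverse of `a ∈ L`: the largest `x` with `a x ≤ y`. For `a ∈ L` and `y ≥ min a` this is the
largest solution `x` of `a x = y` (`ClassL.apply_inv`); where `a` is strictly increasing it is the
inverse function of `a` (`ClassL.inv_apply`). -/
noncomputable def inv (a : ℝ → ℝ) (y : ℝ) : ℝ := sSup {x | a x ≤ y}

theorem ClassL.apply_inv {a : ℝ → ℝ} (ha : ClassL a) {y x : ℝ} (hx : a x ≤ y) :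
    a (inv a y) = y := by
  have hbdd : BddAbove {x | a x ≤ y} := by
    obtain ⟨M, hM⟩ := eventually_atTop.1 (ha.tendsto_atTop.eventually_gt_atTop y)
    refine ⟨M, fun z hz => ?_⟩
    by_contra h
    exact absurd (hM z (not_le.1 h).le) (not_lt.2 hz)
  have hcl : IsClosed {x | a x ≤ y} := isClosed_le ha.continuous continuous_const
  have hmem : a (inv a y) ≤ y := hcl.csSup_mem ⟨x, hx⟩ hbdd
  refine le_antisymm hmem (not_lt.1 fun hlt => ?_)
  have hev : ∀ᶠ z in 𝓝[>] (inv a y), a z < y :=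
    (ha.continuous.continuousAt.eventually_lt continuousAt_const hlt).filter_mono
      nhdsWithin_le_nhds
  obtain ⟨z, hz, hz'⟩ := (hev.and self_mem_nhdsWithin).exists
  exact absurd (le_csSup hbdd hz.le) (not_le.2 hz')

theorem ClassL.inv_apply {a : ℝ → ℝ} {x₀ : ℝ} (hmono : StrictMonoOn a (Ici x₀)) {x : ℝ}
    (hx : x₀ ≤ x) : inv a (a x) = x := by
  have : IsGreatest {z | a z ≤ a x} x := by
    refine ⟨le_refl (a x), fun z hz => ?_⟩
    by_contra h
    have h' := not_le.1 h
    exact absurd (hmono hx (hx.trans h'.le) h') (not_lt.2 hz)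
  exact this.csSup_eq

/-- The standing assumptions on the triple `(α, β, γ)`. -/
structure Admissible (α β γ : ℝ → ℝ) : Prop where
  alpha : ClassL1 α
  beta : ClassL2 β
  gamma : ClassL3 γ
  alpha_log_iter : ∀ p : ℕ, 2 ≤ p →
    (fun x => α (Real.log^[p] x)) =o[atTop] fun x => β (Real.log (γ x))
  alpha_log : (fun x => α (Real.log x)) =o[atTop] α
  alpha_inv : ∀ k : ℝ, 0 ≤ k → k < 1 → (fun x => inv α (k * x)) =o[atTop] inv α

/-- The integrated counting function `N(r, f)` of the poles of `f`, for `0 < r < 1` and `f`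
meromorphic in the unit disc. Every pole is counted with multiplicity:
`N(r, f) = ∑_{0 < |z| ≤ r} n_z log (r / |z|) + n_0 log r`, where `n_z` is the order of the pole at
`z`; this equals `∫₀ʳ (n(t, f) - n(0, f)) / t dt + n(0, f) log r`. (The term `z = 0` of the sum
vanishes, because `‖0‖⁻¹ = 0` and `Real.log 0 = 0`.) -/
noncomputable def logCounting (f : ℂ → ℂ) (r : ℝ) : ℝ :=
  ∑ᶠ z, ((MeromorphicOn.divisor f (Metric.closedBall 0 |r|))⁻ z : ℝ) * Real.log (r * ‖z‖⁻¹)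
    + ((MeromorphicOn.divisor f (Metric.closedBall 0 |r|))⁻ 0 : ℝ) * Real.log r

/-- The Nevanlinna characteristic `T(r, f) = m(r, f) + N(r, f)`. Here `proximity f ⊤ r` is the mean
value `m(r, f)` of `log⁺ |f|` over the circle of radius `r`. -/
noncomputable def characteristic (f : ℂ → ℂ) (r : ℝ) : ℝ :=
  ValueDistribution.proximity f ⊤ r + logCounting f r

/-- The `(α(log), β, γ)`-order of a meromorphic function in the unit disc:
`limsup_{r → 1⁻} α (log log T(r, f)) / β (log γ (1 / (1 - r)))`, an extended real number.
The logarithms of `T` are truncated at `0`, so that the quotient is also meaningful when `T(r, f)`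
is small; as `α` is bounded on bounded sets, this does not change the upper limit. -/
noncomputable def logOrder (α β γ : ℝ → ℝ) (f : ℂ → ℂ) : EReal :=
  limsup (fun r : ℝ =>
    ((α (Real.posLog (Real.posLog (characteristic f r)))
      / β (Real.log (γ (1 / (1 - r)))) : ℝ) : EReal)) (𝓝[<] (1 : ℝ))

/-- `F ⊆ [0, 1)` is a (measurable) set with finite logarithmic measure `∫_F dr / (1 - r) < ∞`. -/
def FiniteLogMeasure (F : Set ℝ) : Prop :=
  F ⊆ Ico 0 1 ∧ MeasurableSet F ∧ ∫⁻ r in F, ENNReal.ofReal (1 / (1 - r)) < ⊤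

end UnitDisc

/-! The heart is a lemma on the logarithmic derivative without exceptional set: `m(r, f'/f)` is at
most a constant plus `3 (log⁺ T(R) + log⁺ T(R')) + 5 log (1/(1-r))`, where `1-R` and `1-R'` are
`3/4` and `1/2` of `1-r` (`exists_proximity_logDeriv_le`). On `|z| ≤ R` write `f = ∏ (z-u)^{D u} ·
g` with `g` analytic and zero-free. Differentiating the Herglotz integral of `log |g|` bounds `g'/g`
by the mean of `|log |g||`, which Jensen's formula controls by `T(R)` and the number of zeros and
poles. That number is at most of order `T(R')/(1-r)`, and it enters the mean of `log⁺ |∑ D u/(z-u)|`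
only through its logarithm, because `|z-u|^{-1/2}` has circle means bounded uniformly in `u`.

Put `M_s(r) = exp (α⁻¹(s β(log γ(1/(1-r)))))`. Finite order says `log⁺ T ≤ M_s` near `1` for every
`s > ϱ`. Halving `1-r` moves `log γ` by at most `log 2`, so by `L₂` it costs only an arbitrarily
small increase of `s`; the hypothesis on `α(log log x)` absorbs `log (1/(1-r))`. Hence larger radii
do no harm and the exceptional set can be empty. For higher derivatives, `T(f')` is controlled by
`T(f)` and `m(r, f'/f)`, and `f^(k)/f` telescopes into logarithmic derivatives. -/

section

open Real InnerProductSpace Complex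

/-! ### Logarithmic derivatives of zero-free analytic functions -/

/-- For a zero-free analytic function `g`, the logarithmic derivative inside a disc is controlled by
the mean of `|log ‖g‖|` over the boundary circle. -/
theorem norm_logDeriv_le_of_ne_zero {g : ℂ → ℂ} {R : ℝ}
    (hg : AnalyticOnNhd ℂ g (Metric.closedBall 0 R))
    (hg0 : ∀ z ∈ Metric.closedBall 0 R, g z ≠ 0) {w : ℂ} (hw : w ∈ Metric.ball 0 R) :
    ‖logDeriv g w‖ ≤ 2 * R / (R - ‖w‖) ^ 2 * circleAverage (fun z => |Real.log ‖g z‖|) 0 R := by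
  have hR : 0 < R := Metric.pos_of_mem_ball hw
  have hwR : ‖w‖ < R := by simpa using hw
  have hharm : HarmonicOnNhd (fun z => Real.log ‖g z‖) (Metric.closedBall 0 R) :=
    fun x hx => (hg x hx).harmonicAt_log_norm (hg0 x hx)
  have hcont : ContinuousOn (fun z => Real.log ‖g z‖) (Metric.sphere 0 R) := by
    intro z hz
    have hz' := Metric.sphere_subset_closedBall hz
    exact (((hg z hz').continuousAt.norm).log (norm_ne_zero_iff.2 (hg0 z hz'))).continuousWithinAt
  have hint : CircleIntegrable (fun z => Real.log ‖g z‖) 0 R := hcont.circleIntegrable hR.le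
  have hintC : CircleIntegrable (fun z => ((Real.log ‖g z‖ : ℝ) : ℂ)) 0 R :=
    (Complex.continuous_ofReal.comp_continuousOn hcont).circleIntegrable hR.le
  -- The Herglotz integral is holomorphic with real part `log ‖g‖`, so it serves as a logarithm of
  -- `g` without choosing a branch.
  set F : ℂ → ℂ := fun w ↦ circleAverage
    (fun ζ ↦ herglotzRieszKernel 0 w ζ • ((Real.log ‖g ζ‖ : ℝ) : ℂ)) 0 R with hF
  have hFre : ∀ z ∈ Metric.ball (0 : ℂ) R, (F z).re = Real.log ‖g z‖ := by
    intro z hz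
    rw [hF]
    simp only
    rw [re_circleAverage_herglotzRieszKernel_smul hint hz]
    exact hharm.circleAverage_re_herglotzRieszKernel_smul hz
  have hFd : ∀ z ∈ Metric.ball (0 : ℂ) R, HasDerivAt F (circleAverage
      (fun ζ ↦ (2 * ζ / (ζ - z) ^ 2) • ((Real.log ‖g ζ‖ : ℝ) : ℂ)) 0 R) z := fun z hz =>
    hasDerivAt_circleAverage_herglotzRieszKernel_smul hintC hz
  have hgd : ∀ z ∈ Metric.ball (0 : ℂ) R, DifferentiableAt ℂ g z := fun z hz =>
    (hg z (Metric.ball_subset_closedBall hz)).differentiableAt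
  -- `q` has modulus one, hence is constant by the maximum principle; its vanishing derivative says
  -- `g'/g = F'`.
  set q : ℂ → ℂ := fun z => g z * Complex.exp (-F z) with hq
  have hqn : ∀ z ∈ Metric.ball (0 : ℂ) R, ‖q z‖ = 1 := by
    intro z hz
    have h0 : 0 < ‖g z‖ := norm_pos_iff.2 (hg0 z (Metric.ball_subset_closedBall hz))
    simp only [hq, norm_mul, Complex.norm_exp, Complex.neg_re, hFre z hz, Real.exp_neg,
      Real.exp_log h0]
    exact mul_inv_cancel₀ h0.ne'
  have hqd : ∀ z ∈ Metric.ball (0 : ℂ) R, DifferentiableAt ℂ q z := fun z hz =>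
    (hgd z hz).mul ((hFd z hz).differentiableAt.neg.cexp)
  have hqc : EqOn q (Function.const ℂ (q w)) (Metric.ball 0 R) := by
    refine Complex.eqOn_of_isPreconnected_of_isMaxOn_norm
      (convex_ball (0 : ℂ) R).isPreconnected Metric.isOpen_ball
      (fun z hz => (hqd z hz).differentiableWithinAt) hw ?_
    intro z hz
    simp [hqn z hz, hqn w hw]
  have hder : logDeriv g w = circleAverage
      (fun ζ ↦ (2 * ζ / (ζ - w) ^ 2) • ((Real.log ‖g ζ‖ : ℝ) : ℂ)) 0 R := by
    have h1 : HasDerivAt q _ w := (hgd w hw).hasDerivAt.mul (hFd w hw).neg.cexp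
    have h2 : HasDerivAt q 0 w :=
      (hasDerivAt_const w (q w)).congr_of_eventuallyEq
        (hqc.eventuallyEq_of_mem (Metric.isOpen_ball.mem_nhds hw))
    have h3 := h1.unique h2
    have h4 := hg0 w (Metric.ball_subset_closedBall hw)
    have h5 := Complex.exp_ne_zero (-F w)
    rw [logDeriv_apply, div_eq_iff h4]
    have h6 : Complex.exp (-F w) * (deriv g w - g w * circleAverage
      (fun ζ ↦ (2 * ζ / (ζ - w) ^ 2) • ((Real.log ‖g ζ‖ : ℝ) : ℂ)) 0 R) = 0 := by
      simp only [Pi.neg_apply] at h3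
      linear_combination h3
    rcases mul_eq_zero.1 h6 with h | h
    · exact absurd h h5
    · rw [sub_eq_zero.1 h, mul_comm]
  rw [hder, ← smul_eq_mul (2 * R / (R - ‖w‖) ^ 2), ← circleAverage_fun_smul]
  have hintA : CircleIntegrable (fun z => (2 * R / (R - ‖w‖) ^ 2) • |Real.log ‖g z‖|) 0 R :=
    (hcont.abs.const_smul (2 * R / (R - ‖w‖) ^ 2)).circleIntegrable hR.le
  rw [circleAverage_def, circleAverage_def, norm_smul, smul_eq_mul, Real.norm_of_nonneg
    (by positivity)]
  refine mul_le_mul_of_nonneg_left ?_ (by positivity)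
  refine intervalIntegral.norm_integral_le_of_norm_le Real.two_pi_pos.le
    (Filter.Eventually.of_forall fun θ _ => ?_) hintA
  have hζ : ‖circleMap 0 R θ‖ = R := by simp [abs_of_pos hR]
  have hd : R - ‖w‖ ≤ ‖circleMap 0 R θ - w‖ := by
    have := norm_sub_norm_le (circleMap 0 R θ) w
    rwa [hζ] at this
  have hd0 : 0 < R - ‖w‖ := sub_pos.2 hwR
  simp only [norm_div, norm_mul, norm_pow, hζ, Complex.norm_real, Real.norm_eq_abs,
    smul_eq_mul, Complex.norm_ofNat]
  gcongr

/-! ### Circle means of `|z-a|^{-1/2}` -/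

/-- By Jordan's inequality the singularities at `0` and `π` are no worse than `x^{-1/2}`. -/
theorem intervalIntegrable_sqrt_inv_abs_sin (a b : ℝ) :
    IntervalIntegrable (fun θ => √|Real.sin θ|⁻¹) volume a b := by
  have hper : Function.Periodic (fun θ => √|Real.sin θ|⁻¹) π := fun θ => by
    simp [Real.sin_add_pi]
  refine hper.intervalIntegrable₀ Real.pi_ne_zero ?_ a b
  have h1 : IntervalIntegrable (fun θ : ℝ => θ ^ (-(1 / 2) : ℝ)) volume 0 π :=
    intervalIntegral.intervalIntegrable_rpow' (by norm_num)
  have h2 : IntervalIntegrable (fun θ : ℝ => (π - θ) ^ (-(1 / 2) : ℝ)) volume 0 π := by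
    have := (h1.comp_sub_left π).symm
    simpa using this
  refine ((h1.add h2).const_mul (√(π / 2))).mono_fun'
    (by fun_prop : Measurable fun θ => √|Real.sin θ|⁻¹).aestronglyMeasurable ?_
  rw [uIoc_of_le Real.pi_pos.le, ← restrict_Ioo_eq_restrict_Ioc]
  refine (ae_restrict_iff' measurableSet_Ioo).2 (Filter.Eventually.of_forall fun θ hθ => ?_)
  have key : ∀ x : ℝ, 0 < x → x ≤ π / 2 →
      √(Real.sin x)⁻¹ ≤ √(π / 2) * x ^ (-(1 / 2) : ℝ) := by
    intro x hx hx'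
    rw [Real.rpow_neg hx.le, ← Real.sqrt_eq_rpow, ← Real.sqrt_inv, ← Real.sqrt_mul (by positivity)]
    refine Real.sqrt_le_sqrt ?_
    have := Real.mul_le_sin hx.le hx'
    calc (Real.sin x)⁻¹ ≤ (2 / π * x)⁻¹ := inv_anti₀ (by positivity) this
      _ = π / 2 * x⁻¹ := by field_simp
  have hs : 0 < Real.sin θ := Real.sin_pos_of_mem_Ioo hθ
  have hθ' : 0 < π - θ := sub_pos.2 hθ.2
  beta_reduce
  rw [Real.norm_of_nonneg (by positivity), abs_of_pos hs, mul_add]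
  rcases le_total θ (π / 2) with h | h
  · exact (key θ hθ.1 h).trans (le_add_of_nonneg_right (by positivity))
  · rw [← Real.sin_pi_sub]
    refine (key (π - θ) hθ' (by linarith)).trans (le_add_of_nonneg_left ?_)
    have := hθ.1
    positivity

/-- After rotation by `-arg a` the point `a` is real, so the imaginary part of the difference no
longer sees it. -/
theorem mul_abs_sin_le_norm_circleMap_sub {r : ℝ} (hr : 0 ≤ r) (a : ℂ) (θ : ℝ) :
    r * |Real.sin (θ - a.arg)| ≤ ‖circleMap 0 r θ - a‖ := by
  have h1 : (circleMap 0 r θ - a) * Complex.exp (-(a.arg * Complex.I)) =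
      r * Complex.exp (((θ - a.arg : ℝ) : ℂ) * Complex.I) - ‖a‖ := by
    have h2 : a * Complex.exp (-(a.arg * Complex.I)) = ‖a‖ := by
      calc a * Complex.exp (-(a.arg * Complex.I))
          = ‖a‖ * Complex.exp (a.arg * Complex.I) * Complex.exp (-(a.arg * Complex.I)) := by
            rw [Complex.norm_mul_exp_arg_mul_I]
        _ = ‖a‖ := by rw [mul_assoc, ← Complex.exp_add, add_neg_cancel, Complex.exp_zero, mul_one]
    rw [sub_mul, h2, circleMap_zero, mul_assoc, ← Complex.exp_add]
    push_cast
    ring_nf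
  have h3 : ‖Complex.exp (-(a.arg * Complex.I))‖ = 1 := by
    rw [Complex.norm_exp]; simp
  calc r * |Real.sin (θ - a.arg)|
      = |((r : ℂ) * Complex.exp (((θ - a.arg : ℝ) : ℂ) * Complex.I) - ‖a‖).im| := by
        rw [Complex.sub_im, Complex.im_ofReal_mul, Complex.exp_ofReal_mul_I_im, Complex.ofReal_im,
          sub_zero, abs_mul, abs_of_nonneg hr]
    _ ≤ ‖(r : ℂ) * Complex.exp (((θ - a.arg : ℝ) : ℂ) * Complex.I) - ‖a‖‖ :=
        Complex.abs_im_le_norm _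
    _ = ‖circleMap 0 r θ - a‖ := by rw [← h1, norm_mul, h3, mul_one]

theorem exists_circleAverage_sqrt_inv_norm_sub_le : ∃ C : ℝ, 0 ≤ C ∧ ∀ r : ℝ, 0 < r → ∀ a : ℂ,
    CircleIntegrable (fun z => √‖z - a‖⁻¹) 0 r ∧
      circleAverage (fun z => √‖z - a‖⁻¹) 0 r ≤ C * √r⁻¹ := by
  set S : ℝ → ℝ := fun θ => √|Real.sin θ|⁻¹ with hS
  have hper : Function.Periodic S (2 * π) := fun θ => by simp [hS, Real.sin_add_two_pi]
  refine ⟨(2 * π)⁻¹ * ∫ θ in 0..2 * π, S θ, mul_nonneg (by positivity)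
    (intervalIntegral.integral_nonneg Real.two_pi_pos.le fun _ _ => Real.sqrt_nonneg _),
    fun r hr a => ?_⟩
  have hSi : IntervalIntegrable (fun θ => S (θ - a.arg) * √r⁻¹) volume 0 (2 * π) := by
    have := (intervalIntegrable_sqrt_inv_abs_sin (0 - a.arg) (2 * π - a.arg)).comp_sub_right a.arg
    simpa [hS] using this.mul_const (√r⁻¹)
  -- Where the sine vanishes, `0⁻¹ = 0` makes `S` zero and the pointwise bound can fail; these
  -- angles form a null set.
  have hzero : ∀ᵐ θ : ℝ, Real.sin (θ - a.arg) ≠ 0 := by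
    have hc : {θ : ℝ | Real.sin (θ - a.arg) = 0} ⊆ range (fun n : ℤ => n * π + a.arg) := by
      intro θ hθ
      obtain ⟨n, hn⟩ := Real.sin_eq_zero_iff.1 hθ
      exact ⟨n, by simp [hn]⟩
    have := ((countable_range _).mono hc).measure_zero volume
    rw [ae_iff]
    simpa using this
  have hle : ∀ᵐ θ : ℝ, √‖circleMap 0 r θ - a‖⁻¹ ≤ S (θ - a.arg) * √r⁻¹ := by
    filter_upwards [hzero] with θ hθ
    rw [hS]
    simp only
    rw [← Real.sqrt_mul (by positivity), ← mul_inv, mul_comm]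
    exact Real.sqrt_le_sqrt (inv_anti₀ (mul_pos hr (abs_pos.2 hθ))
      (mul_abs_sin_le_norm_circleMap_sub hr.le a θ))
  have hci : CircleIntegrable (fun z => √‖z - a‖⁻¹) 0 r := by
    refine hSi.mono_fun' (by fun_prop : Measurable fun θ =>
      √‖circleMap 0 r θ - a‖⁻¹).aestronglyMeasurable (ae_restrict_of_ae ?_)
    filter_upwards [hle] with θ hθ
    rwa [Real.norm_of_nonneg (Real.sqrt_nonneg _)]
  refine ⟨hci, ?_⟩
  rw [circleAverage_def, smul_eq_mul, mul_assoc]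
  refine mul_le_mul_of_nonneg_left ?_ (by positivity)
  calc ∫ θ in 0..2 * π, √‖circleMap 0 r θ - a‖⁻¹
      ≤ ∫ θ in 0..2 * π, S (θ - a.arg) * √r⁻¹ :=
        intervalIntegral.integral_mono_ae Real.two_pi_pos.le hci hSi hle
    _ = (∫ θ in 0..2 * π, S θ) * √r⁻¹ := by
        rw [intervalIntegral.integral_mul_const, intervalIntegral.integral_comp_sub_right,
          show 2 * π - a.arg = (0 - a.arg) + 2 * π by ring,
          hper.intervalIntegral_add_eq (0 - a.arg) 0, zero_add]

/-! ### Logarithmic derivative of a factorised function -/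

/-- Split `log x = 2 log (1+N) + 2 log (√x/(1+N))` and use `log y ≤ y`. This replaces the concavity
of the logarithm: with `N` the number of zeros and poles, the last term will have bounded mean. -/
theorem Real.posLog_le_two_mul_log_add {x N : ℝ} (hx : 0 ≤ x) (hN : 0 ≤ N) :
    log⁺ x ≤ 2 * Real.log (1 + N) + 2 / (1 + N) * √x := by
  have hN1 : 0 < 1 + N := by linarith
  have h0 : 0 ≤ Real.log (1 + N) := Real.log_nonneg (by linarith)
  have h1 : 0 ≤ 2 / (1 + N) * √x := by positivity
  rw [posLog_apply]
  refine max_le (by linarith) ?_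
  rcases hx.eq_or_lt with rfl | hx
  · simp only [Real.log_zero]; linarith
  have h2 : Real.log x = 2 * Real.log (1 + N) + 2 * Real.log (√x / (1 + N)) := by
    rw [Real.log_div (by positivity) hN1.ne', Real.log_sqrt hx.le]
    ring
  rw [h2]
  have h3 : Real.log (√x / (1 + N)) ≤ √x / (1 + N) := Real.log_le_self (by positivity)
  have h4 : 2 / (1 + N) * √x = 2 * (√x / (1 + N)) := by ring
  linarith

/-- The square root is subadditive, and `√|n| ≤ |n|` for integers. -/
theorem sqrt_norm_sum_div_sub_le (s : Finset ℂ) (n : ℂ → ℤ) (z : ℂ) :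
    √‖∑ u ∈ s, (n u : ℂ) / (z - u)‖ ≤ ∑ u ∈ s, |(n u : ℝ)| * √‖z - u‖⁻¹ := by
  classical
  induction s using Finset.induction_on with
  | empty => simp
  | insert a s ha ih =>
    rw [Finset.sum_insert ha, Finset.sum_insert ha]
    calc √‖(n a : ℂ) / (z - a) + ∑ u ∈ s, (n u : ℂ) / (z - u)‖
        ≤ √(‖(n a : ℂ) / (z - a)‖ + ‖∑ u ∈ s, (n u : ℂ) / (z - u)‖) :=
          Real.sqrt_le_sqrt (norm_add_le _ _)
      _ ≤ √‖(n a : ℂ) / (z - a)‖ + √‖∑ u ∈ s, (n u : ℂ) / (z - u)‖ :=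
          Real.sqrt_le_iff.2 ⟨by positivity, by
            rw [add_sq, Real.sq_sqrt (norm_nonneg _), Real.sq_sqrt (norm_nonneg _)]
            have : 0 ≤ 2 * √‖(n a : ℂ) / (z - a)‖ * √‖∑ u ∈ s, (n u : ℂ) / (z - u)‖ := by
              positivity
            linarith⟩
      _ ≤ |(n a : ℝ)| * √‖z - a‖⁻¹ + ∑ u ∈ s, |(n u : ℝ)| * √‖z - u‖⁻¹ := by
          refine add_le_add ?_ ih
          rw [norm_div, div_eq_mul_inv, Real.sqrt_mul (norm_nonneg _), Complex.norm_intCast]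
          refine mul_le_mul_of_nonneg_right ?_ (Real.sqrt_nonneg _)
          rw [Real.sqrt_le_left (abs_nonneg _), ← Int.cast_abs, ← Int.cast_pow, Int.cast_le]
          nlinarith [abs_nonneg (n a), Int.le_self_sq |n a|]

/-- The identity is needed only off a discrete set, which circle means ignore. -/
theorem MeromorphicOn.logDeriv_eventuallyEq_of_factorization {f g : ℂ → ℂ} {U : Set ℂ} {D : ℂ → ℤ}
    (hD : D.support.Finite) (hf : MeromorphicOn f U) (hg : AnalyticOnNhd ℂ g U)
    (hg0 : ∀ u ∈ U, g u ≠ 0)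
    (h : f =ᶠ[codiscreteWithin U] (∏ᶠ u, (· - u) ^ D u) • g) :
    logDeriv f =ᶠ[codiscreteWithin U]
      fun z => (∑ u ∈ hD.toFinset, (D u : ℂ) / (z - u)) + logDeriv g z := by
  have hsub : ∀ u : ℂ, MeromorphicOn (fun z => z - u) U := fun u x _ => by fun_prop
  have hsub0 : ∀ u : ℂ, ∀ x ∈ U, meromorphicOrderAt (fun z => z - u) x ≠ ⊤ := fun u x _ => by
    rw [meromorphicOrderAt_ne_top_iff_eventually_ne_zero (by fun_prop)]
    rcases eq_or_ne x u with rfl | hxu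
    · filter_upwards [self_mem_nhdsWithin] with z hz using sub_ne_zero.2 hz
    · filter_upwards [nhdsWithin_le_nhds (isOpen_ne.mem_nhds hxu)] with z hz using sub_ne_zero.2 hz
  have hφ : MeromorphicOn (∏ᶠ u, (· - u) ^ D u) U :=
    (Function.FactorizedRational.meromorphicNFOn D U).meromorphicOn
  have hφg : MeromorphicOn ((∏ᶠ u, (· - u) ^ D u) • g) U := hφ.smul hg.meromorphicOn
  have h1 := hf.deriv_eventuallyEq_codiscreteWithin hφg h
  have h2 := hφ.logDeriv_mul_eventuallyEq hg.meromorphicOn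
    (fun x _ => Function.FactorizedRational.meromorphicOrderAt_ne_top D)
    (fun x hx => by
      rw [((hg x hx).meromorphicNFAt).meromorphicOrderAt_eq_zero_iff.2 (hg0 x hx)]
      simp)
  have h3 := MeromorphicOn.logDeriv_finprod_zpow_eventuallyEq hD hsub hsub0
  filter_upwards [h, h1, h2, h3] with z hz hz1 hz2 hz3
  rw [logDeriv_apply, hz, hz1, ← logDeriv_apply, smul_eq_mul, hz2, Pi.add_apply]
  congr 1
  rw [show (∏ᶠ u : ℂ, (fun z => z - u) ^ D u) = ∏ᶠ u : ℂ, (· - u) ^ D u from rfl] at hz3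
  rw [hz3, finsum_eq_sum_of_support_subset (s := hD.toFinset)]
  · refine Finset.sum_congr rfl fun u _ => ?_
    simp [logDeriv_apply, div_eq_mul_inv]
  · intro u hu
    simp only [Function.mem_support, ne_eq, Set.Finite.coe_toFinset] at hu ⊢
    intro h0
    exact hu (by simp [h0])

/-- The weight `2/(1+N)` turns the sum of the `N` singular means into `2C · N/(1+N) ≤ 2C`, so `N`
survives only inside a logarithm. -/
theorem proximity_logDeriv_le_of_factorization {f g : ℂ → ℂ} {R r C : ℝ} {D : ℂ → ℤ}
    (hD : D.support.Finite) (hf : MeromorphicOn f (Metric.closedBall 0 R))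
    (hg : AnalyticOnNhd ℂ g (Metric.closedBall 0 R))
    (hg0 : ∀ u ∈ Metric.closedBall 0 R, g u ≠ 0)
    (h : f =ᶠ[codiscreteWithin (Metric.closedBall 0 R)] (∏ᶠ u, (· - u) ^ D u) • g)
    (hr : 0 < r) (hrR : r < R)
    (hC : ∀ a : ℂ, CircleIntegrable (fun z => √‖z - a‖⁻¹) 0 r ∧
      circleAverage (fun z => √‖z - a‖⁻¹) 0 r ≤ C) :
    ValueDistribution.proximity (logDeriv f) ⊤ r ≤
      log⁺ (2 * R / (R - r) ^ 2 * circleAverage (fun z => |Real.log ‖g z‖|) 0 R)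
        + 2 * Real.log (1 + ∑ u ∈ hD.toFinset, |(D u : ℝ)|) + (2 * C + Real.log 2) := by
  have hss : Metric.sphere (0 : ℂ) |r| ⊆ Metric.closedBall 0 R := by
    rw [abs_of_pos hr]
    exact Metric.sphere_subset_closedBall.trans (Metric.closedBall_subset_closedBall hrR.le)
  set N := ∑ u ∈ hD.toFinset, |(D u : ℝ)| with hN
  have hN0 : 0 ≤ N := Finset.sum_nonneg fun _ _ => abs_nonneg _
  set B := 2 * R / (R - r) ^ 2 * circleAverage (fun z => |Real.log ‖g z‖|) 0 R with hB
  have heq := (MeromorphicOn.logDeriv_eventuallyEq_of_factorization hD hf hg hg0 h).filter_mono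
    (codiscreteWithin_mono hss)
  set Q : ℂ → ℂ := fun z => (∑ u ∈ hD.toFinset, (D u : ℂ) / (z - u)) + logDeriv g z with hQ
  rw [ValueDistribution.proximity_congr_codiscreteWithin heq hr.ne', ValueDistribution.proximity_top]
  have hQm : MeromorphicOn Q (Metric.sphere 0 |r|) := by
    intro z hz
    refine MeromorphicAt.add ?_ (hg z (hss hz)).meromorphicAt.logDeriv
    refine MeromorphicAt.fun_sum fun u => ?_
    fun_prop
  set W : ℂ → ℝ := fun z => (log⁺ B + 2 * Real.log (1 + N) + Real.log 2) +
      ∑ u ∈ hD.toFinset, (2 / (1 + N) * |(D u : ℝ)|) • √‖z - u‖⁻¹ with hW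
  have hterm : ∀ u ∈ hD.toFinset,
      CircleIntegrable (fun z => (2 / (1 + N) * |(D u : ℝ)|) • √‖z - u‖⁻¹) 0 r :=
    fun u _ => (hC u).1.const_smul
  have hsumint : CircleIntegrable (fun z => ∑ u ∈ hD.toFinset,
      (2 / (1 + N) * |(D u : ℝ)|) • √‖z - u‖⁻¹) 0 r := CircleIntegrable.fun_sum _ hterm
  have hWint : CircleIntegrable W 0 r := (circleIntegrable_const _ _ _).add hsumint
  have hC0 : 0 ≤ C := (circleAverage_nonneg_of_nonneg fun _ _ => Real.sqrt_nonneg _).trans (hC 0).2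
  calc circleAverage (fun z => log⁺ ‖Q z‖) 0 r ≤ circleAverage W 0 r := by
        refine circleAverage_mono hQm.circleIntegrable_posLog_norm hWint fun z hz => ?_
        have hzr : ‖z‖ = r := by simpa [abs_of_pos hr] using hz
        have hb : ‖logDeriv g z‖ ≤ B := by
          have := norm_logDeriv_le_of_ne_zero hg hg0 (w := z) (by simpa [hzr] using hrR)
          rwa [hzr] at this
        have h1 : log⁺ ‖Q z‖ ≤ log⁺ ‖∑ u ∈ hD.toFinset, (D u : ℂ) / (z - u)‖ +
            log⁺ ‖logDeriv g z‖ + Real.log 2 := posLog_norm_add_le _ _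
        have h2 := Real.posLog_le_posLog (norm_nonneg _) hb
        have h3 := Real.posLog_le_two_mul_log_add
          (norm_nonneg (∑ u ∈ hD.toFinset, (D u : ℂ) / (z - u))) hN0
        have h4 := mul_le_mul_of_nonneg_left (sqrt_norm_sum_div_sub_le hD.toFinset D z)
          (by positivity : 0 ≤ 2 / (1 + N))
        rw [Finset.mul_sum] at h4
        simp only [hW, smul_eq_mul, mul_assoc] at h4 ⊢
        linarith
    _ = (log⁺ B + 2 * Real.log (1 + N) + Real.log 2) + ∑ u ∈ hD.toFinset,
          (2 / (1 + N) * |(D u : ℝ)|) * circleAverage (fun z => √‖z - u‖⁻¹) 0 r := by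
        rw [hW, circleAverage_fun_add (circleIntegrable_const _ _ _) hsumint, circleAverage_const,
          circleAverage_fun_sum hterm]
        simp only [circleAverage_fun_smul]
        simp only [smul_eq_mul]
    _ ≤ (log⁺ B + 2 * Real.log (1 + N) + Real.log 2) + ∑ u ∈ hD.toFinset,
          (2 / (1 + N) * |(D u : ℝ)|) * C := by
        gcongr with u _
        exact (hC u).2
    _ = (log⁺ B + 2 * Real.log (1 + N) + Real.log 2) + 2 * C * (N / (1 + N)) := by
        rw [← Finset.sum_mul, ← Finset.mul_sum]
        ring
    _ ≤ _ := by
        have : N / (1 + N) ≤ 1 := (div_le_one (by linarith)).2 (by linarith)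
        have := mul_le_mul_of_nonneg_left this (by positivity : 0 ≤ 2 * C)
        linarith

/-! ### Jensen's formula and the counting of poles -/

namespace UnitDisc

open ValueDistribution MeromorphicOn

theorem circleAverage_abs_log_norm {f : ℂ → ℂ} {r : ℝ}
    (hf : MeromorphicOn f (Metric.sphere 0 |r|)) :
    circleAverage (fun z => |Real.log ‖f z‖|) 0 r =
      proximity f ⊤ r + proximity f⁻¹ ⊤ r := by
  rw [proximity_top, proximity_top,
    ← circleAverage_fun_add hf.circleIntegrable_posLog_norm hf.inv.circleIntegrable_posLog_norm]
  congr 1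
  ext z
  rw [Pi.inv_apply, norm_inv]
  have := Real.half_mul_log_add_log_abs (x := ‖f z‖)
  have := Real.half_mul_log_add_log_abs (x := ‖f z‖⁻¹)
  rw [Real.log_inv, abs_neg] at this
  linarith

theorem proximity_sub_proximity_inv {f : ℂ → ℂ} {r : ℝ}
    (hf : MeromorphicOn f (Metric.sphere 0 |r|)) :
    proximity f ⊤ r - proximity f⁻¹ ⊤ r = circleAverage (fun z => Real.log ‖f z‖) 0 r := by
  rw [proximity_top, proximity_top,
    ← circleAverage_fun_sub hf.circleIntegrable_posLog_norm hf.inv.circleIntegrable_posLog_norm]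
  congr 1
  ext z
  rw [Pi.inv_apply, norm_inv, posLog_sub_posLog_inv]

theorem logCounting_eq_sum {f : ℂ → ℂ} {r : ℝ} {s : Finset ℂ}
    (hs : (divisor f (Metric.closedBall 0 |r|)).support ⊆ s) :
    logCounting f r =
      ∑ z ∈ s, ((divisor f (Metric.closedBall 0 |r|))⁻ z : ℝ) * Real.log (r * ‖z‖⁻¹)
        + ((divisor f (Metric.closedBall 0 |r|))⁻ 0 : ℝ) * Real.log r := by
  rw [logCounting, finsum_eq_sum_of_support_subset]
  intro z hz
  refine hs fun h => ?_
  simp [h] at hz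

/-- **Jensen's formula** in terms of the Nevanlinna characteristic. -/
theorem characteristic_inv {f : ℂ → ℂ} {r : ℝ} (hr : r ≠ 0)
    (hf : MeromorphicOn f (Metric.closedBall 0 |r|)) :
    characteristic f⁻¹ r = characteristic f r - Real.log ‖meromorphicTrailingCoeffAt f 0‖ := by
  have h1 := MeromorphicOn.circleAverage_log_norm hr hf
  rw [← proximity_sub_proximity_inv (hf.mono_set Metric.sphere_subset_closedBall)] at h1
  set D := divisor f (Metric.closedBall 0 |r|) with hD
  have hfin := D.finiteSupport (isCompact_closedBall 0 |r|)
  have hs : D.support ⊆ hfin.toFinset := by simp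
  have hs' : (divisor f⁻¹ (Metric.closedBall 0 |r|)).support ⊆ hfin.toFinset := by
    rw [divisor_inv]
    intro z hz
    refine hs ?_
    simpa [hD] using hz
  rw [characteristic, characteristic, logCounting_eq_sum hs, logCounting_eq_sum hs', divisor_inv,
    ← hD]
  rw [finsum_eq_sum_of_support_subset (s := hfin.toFinset) _ (by
    intro z hz
    refine hs fun h => ?_
    simp [h] at hz)] at h1
  -- Zeros of `f` are poles of `f⁻¹`: the positive part of `D` is the negative part of `-D`.
  have key : ∀ z, (D z : ℝ) = (((-D)⁻ z : ℤ) : ℝ) - ((D⁻ z : ℤ) : ℝ) := fun z => by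
    rw [← Int.cast_sub]
    simp [negPart_neg, posPart_sub_negPart]
  simp only [zero_sub, norm_neg, key, sub_mul, Finset.sum_sub_distrib] at h1
  linarith

theorem negPart_divisor_nonneg (f : ℂ → ℂ) (U : Set ℂ) (z : ℂ) :
    (0 : ℝ) ≤ ((divisor f U)⁻ z : ℤ) := by
  rw [Function.locallyFinsuppWithin.negPart_apply]
  exact_mod_cast negPart_nonneg _

theorem log_radius_div_nonneg {f : ℂ → ℂ} {r : ℝ} (z : ℂ) :
    0 ≤ ((divisor f (Metric.closedBall 0 |r|))⁻ z : ℝ) * Real.log (r * ‖z‖⁻¹) := by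
  by_cases hz : z ∈ Metric.closedBall 0 |r|
  · refine mul_nonneg (negPart_divisor_nonneg _ _ _) ?_
    rcases eq_or_ne z 0 with rfl | hz0
    · simp
    rw [← Real.log_abs, abs_mul, abs_inv, abs_norm]
    refine Real.log_nonneg ?_
    rw [← div_eq_mul_inv, one_le_div (norm_pos_iff.2 hz0)]
    simpa using hz
  · simp [Function.locallyFinsuppWithin.apply_eq_zero_of_notMem _ hz]

theorem negPart_divisor_apply {f : ℂ → ℂ} {U : Set ℂ} {z : ℂ} (hf : MeromorphicOn f U)
    (hz : z ∈ U) : (divisor f U)⁻ z = ((meromorphicOrderAt f z).untop₀)⁻ := by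
  rw [Function.locallyFinsuppWithin.negPart_apply, divisor_apply hf hz]

/-- Only the pole at the origin can contribute negatively, and `log r ≥ -log 2`. -/
theorem neg_mul_log_two_le_logCounting {f : ℂ → ℂ} {r : ℝ} (hr : 1 / 2 ≤ r)
    (hf : MeromorphicOn f (Metric.closedBall 0 |r|)) :
    -(((meromorphicOrderAt f 0).untop₀)⁻ * Real.log 2) ≤ logCounting f r := by
  have hfin := (divisor f (Metric.closedBall 0 |r|)).finiteSupport (isCompact_closedBall 0 |r|)
  rw [logCounting_eq_sum (s := hfin.toFinset) (by simp)]
  have h1 := Finset.sum_nonneg fun z (_ : z ∈ hfin.toFinset) => log_radius_div_nonneg (f := f) (r := r) z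
  have h2 : -Real.log 2 ≤ Real.log r := by
    rw [← Real.log_inv]
    exact Real.log_le_log (by norm_num) (by linarith)
  have h3 := mul_le_mul_of_nonneg_left h2
    (negPart_divisor_nonneg f (Metric.closedBall 0 |r|) 0)
  rw [negPart_divisor_apply hf (by simp)] at h3 ⊢
  linarith

theorem proximity_le_characteristic_add {f : ℂ → ℂ} {r : ℝ} (hr : 1 / 2 ≤ r)
    (hf : MeromorphicOn f (Metric.closedBall 0 |r|)) :
    proximity f ⊤ r ≤ characteristic f r +
      ((meromorphicOrderAt f 0).untop₀)⁻ * Real.log 2 := by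
  have := neg_mul_log_two_le_logCounting hr hf
  rw [characteristic]
  linarith

/-- A pole with `0 < |z| ≤ r` contributes at least `log (R/r)` to `N(R, f)`. The origin is treated
apart, since its summand vanishes by convention: one `log 2` per multiplicity bounds `log (R/r)`,
the other compensates `log R`. -/
theorem sum_negPart_divisor_mul_log_le {f : ℂ → ℂ} {r R : ℝ} (hr : 1 / 2 ≤ r) (hrR : r ≤ R)
    (hR : R ≤ 1) (hf : MeromorphicOn f (Metric.closedBall 0 R)) (s : Finset ℂ) :
    (∑ z ∈ s, ((divisor f (Metric.closedBall 0 r))⁻ z : ℝ)) * Real.log (R / r) ≤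
      characteristic f R + 2 * (((meromorphicOrderAt f 0).untop₀)⁻ * Real.log 2) := by
  classical
  have hr0 : 0 < r := by linarith
  have hR0 : 0 < R := by linarith
  rw [show Metric.closedBall (0 : ℂ) R = Metric.closedBall 0 |R| by rw [abs_of_pos hR0]] at hf
  set E := divisor f (Metric.closedBall 0 |R|) with hE
  set D := divisor f (Metric.closedBall 0 r) with hD
  have hfin := E.finiteSupport (isCompact_closedBall 0 |R|)
  have hsub : Metric.closedBall (0 : ℂ) r ⊆ Metric.closedBall 0 |R| := by
    rw [abs_of_pos hR0]
    exact Metric.closedBall_subset_closedBall hrR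
  have hl0 : 0 ≤ Real.log (R / r) := Real.log_nonneg ((one_le_div hr0).2 hrR)
  have hl2 : Real.log (R / r) ≤ Real.log 2 :=
    Real.log_le_log (by positivity) ((div_le_iff₀ hr0).2 (by linarith))
  have hDE : ∀ z, D⁻ z ≤ E⁻ z ∧ (z ∉ Metric.closedBall 0 r → D⁻ z = 0) := by
    intro z
    by_cases hz : z ∈ Metric.closedBall 0 r
    · refine ⟨le_of_eq ?_, fun h => absurd hz h⟩
      rw [hD, hE, negPart_divisor_apply (hf.mono_set hsub) hz, negPart_divisor_apply hf (hsub hz)]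
    · have : D⁻ z = 0 := by
        simp [Function.locallyFinsuppWithin.apply_eq_zero_of_notMem _ hz]
      refine ⟨?_, fun _ => this⟩
      rw [this, Function.locallyFinsuppWithin.negPart_apply]
      exact negPart_nonneg _
  set t := insert 0 (s ∪ hfin.toFinset) with ht
  have hp := negPart_divisor_nonneg f (Metric.closedBall 0 |R|)
  rw [← hE] at hp
  have hterm : ∀ z ∈ t, (D⁻ z : ℝ) * Real.log (R / r) ≤
      (E⁻ z : ℝ) * Real.log (R * ‖z‖⁻¹) + if z = 0 then (E⁻ 0 : ℝ) * Real.log 2 else 0 := by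
    intro z _
    have hle : (D⁻ z : ℝ) ≤ E⁻ z := by exact_mod_cast (hDE z).1
    rcases eq_or_ne z 0 with rfl | hz0
    · simp only [norm_zero, inv_zero, mul_zero, Real.log_zero, if_true, zero_add]
      exact mul_le_mul hle hl2 hl0 (hp 0)
    rw [if_neg hz0, add_zero]
    by_cases hz : z ∈ Metric.closedBall 0 r
    · refine mul_le_mul hle ?_ hl0 (hp z)
      rw [div_eq_mul_inv]
      have hz' : ‖z‖ ≤ r := by simpa using hz
      have : 0 < ‖z‖ := norm_pos_iff.2 hz0
      exact Real.log_le_log (by positivity) (by gcongr)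
    · rw [(hDE z).2 hz, Int.cast_zero, zero_mul]
      exact log_radius_div_nonneg z
  have hprox : 0 ≤ proximity f ⊤ R := proximity_nonneg R
  have hlR : -Real.log 2 ≤ Real.log R := by
    rw [← Real.log_inv]
    exact Real.log_le_log (by norm_num) (by linarith)
  have h0 : (E⁻ 0 : ℝ) = (((meromorphicOrderAt f 0).untop₀)⁻ : ℤ) := by
    rw [hE, negPart_divisor_apply hf (by simp)]
  calc (∑ z ∈ s, (D⁻ z : ℝ)) * Real.log (R / r)
      ≤ (∑ z ∈ t, (D⁻ z : ℝ)) * Real.log (R / r) := by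
        refine mul_le_mul_of_nonneg_right (Finset.sum_le_sum_of_subset_of_nonneg ?_
          fun z _ _ => negPart_divisor_nonneg _ _ _) hl0
        exact Finset.subset_union_left.trans (Finset.subset_insert _ _)
    _ ≤ ∑ z ∈ t, ((E⁻ z : ℝ) * Real.log (R * ‖z‖⁻¹) +
          if z = 0 then (E⁻ 0 : ℝ) * Real.log 2 else 0) := by
        rw [Finset.sum_mul]
        exact Finset.sum_le_sum hterm
    _ = logCounting f R - (E⁻ 0 : ℝ) * Real.log R + (E⁻ 0 : ℝ) * Real.log 2 := by
        rw [logCounting_eq_sum (s := t), Finset.sum_add_distrib, Finset.sum_ite_eq',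
          if_pos (Finset.mem_insert_self _ _), ← hE]
        · ring
        · rw [← hE]
          intro z hz
          simp only [ht, Finset.coe_insert, Finset.coe_union, Set.Finite.coe_toFinset]
          exact Or.inr (Or.inr hz)
    _ ≤ _ := by
        rw [characteristic, ← h0]
        have := mul_le_mul_of_nonneg_left hlR (hp 0)
        linarith

/-! ### Removal of zeros and poles -/

/-- If `x ≤ log 2` then `|x| ≤ 2 log 2 - x`, and the mean of `log |z-u|` is exactly `log R ≥ -log
2`. -/
theorem circleAverage_abs_log_norm_sub_le {R : ℝ} (hR : 1 / 2 ≤ R) (hR1 : R ≤ 1) {u : ℂ}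
    (hu : u ∈ Metric.closedBall 0 R) :
    circleAverage (fun z => |Real.log ‖z - u‖|) 0 R ≤ 3 * Real.log 2 := by
  have hR0 : 0 < R := by linarith
  have hi : CircleIntegrable (fun z => Real.log ‖z - u‖) 0 R := circleIntegrable_log_norm_sub_const R
  have hc : CircleIntegrable (fun _ => 2 * Real.log 2) (0 : ℂ) R := circleIntegrable_const _ _ _
  have hlR : -Real.log 2 ≤ Real.log R := by
    rw [← Real.log_inv]
    exact Real.log_le_log (by norm_num) (by linarith)
  calc circleAverage (fun z => |Real.log ‖z - u‖|) 0 R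
      ≤ circleAverage (fun z => 2 * Real.log 2 - Real.log ‖z - u‖) 0 R := by
        refine circleAverage_mono hi.abs (hc.sub hi) fun z hz => ?_
        have hz' : ‖z‖ = R := by simpa [abs_of_pos hR0] using hz
        have hu' : ‖u‖ ≤ R := by simpa using hu
        have h2 : ‖z - u‖ ≤ 2 := (norm_sub_le _ _).trans (by linarith)
        have h3 : Real.log ‖z - u‖ ≤ Real.log 2 := by
          rcases (norm_nonneg (z - u)).eq_or_lt with h | h
          · rw [← h, Real.log_zero]; exact Real.log_nonneg one_le_two
          · exact Real.log_le_log h h2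
        have h4 : 0 ≤ Real.log 2 := Real.log_nonneg one_le_two
        rw [abs_le]
        constructor <;> linarith
    _ = 2 * Real.log 2 - Real.log R := by
        rw [circleAverage_fun_sub hc hi, circleAverage_const,
          circleAverage_log_norm_sub_const_of_mem_closedBall (by rwa [abs_of_pos hR0])]
    _ ≤ 3 * Real.log 2 := by linarith

theorem circleAverage_abs_log_norm_le_of_factorization {f g : ℂ → ℂ} {R : ℝ} (hR : 1 / 2 ≤ R)
    (hR1 : R ≤ 1) {D : Function.locallyFinsuppWithin (Metric.closedBall (0 : ℂ) R) ℤ}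
    (hD : D.support.Finite) (hf : MeromorphicOn f (Metric.closedBall 0 R))
    (hg0 : ∀ u ∈ Metric.closedBall 0 R, g u ≠ 0) (hg : AnalyticOnNhd ℂ g (Metric.closedBall 0 R))
    (h : f =ᶠ[codiscreteWithin (Metric.closedBall 0 R)] (∏ᶠ u, (· - u) ^ D u) • g) :
    circleAverage (fun z => |Real.log ‖g z‖|) 0 R ≤
      circleAverage (fun z => |Real.log ‖f z‖|) 0 R +
        3 * Real.log 2 * ∑ u ∈ hD.toFinset, |(D u : ℝ)| := by
  have hR0 : 0 < R := by linarith
  have hss : Metric.sphere (0 : ℂ) |R| ⊆ Metric.closedBall 0 R := by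
    rw [abs_of_pos hR0]
    exact Metric.sphere_subset_closedBall
  have hlog := (extract_zeros_poles_log (fun u => hg0 u u.2) h).filter_mono
    (codiscreteWithin_mono hss)
  have hterm : ∀ u ∈ hD.toFinset,
      CircleIntegrable (fun z => |(D u : ℝ)| • |Real.log ‖z - u‖|) 0 R := fun u _ =>
    ((circleIntegrable_log_norm_sub_const (a := u) (c := 0) R).abs).const_smul
  have hsum : CircleIntegrable (fun z => ∑ u ∈ hD.toFinset, |(D u : ℝ)| • |Real.log ‖z - u‖|) 0 R :=
    CircleIntegrable.fun_sum _ hterm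
  have hfi : CircleIntegrable (fun z => |Real.log ‖f z‖|) 0 R :=
    (hf.mono_set hss).circleIntegrable_log_norm.abs
  have hgi : CircleIntegrable (fun z => |Real.log ‖g z‖|) 0 R :=
    (hg.meromorphicOn.mono_set hss).circleIntegrable_log_norm.abs
  have heq : (fun z => |Real.log ‖g z‖|) =ᶠ[codiscreteWithin (Metric.sphere 0 |R|)]
      fun z => |Real.log ‖f z‖ - ∑ u ∈ hD.toFinset, (D u : ℝ) * Real.log ‖z - u‖| := by
    filter_upwards [hlog] with z hz
    rw [hz, Pi.add_apply, finsum_eq_sum_of_support_subset (s := hD.toFinset), Finset.sum_apply]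
    · congr 1
      ring
    · intro u hu
      simp only [Function.mem_support, ne_eq, Set.Finite.coe_toFinset] at hu ⊢
      intro h0
      refine hu ?_
      ext z
      simp [h0]
  have hgi' := hgi.congr_codiscreteWithin heq
  rw [circleAverage_congr_codiscreteWithin heq hR0.ne']
  calc _ ≤ circleAverage (fun z => |Real.log ‖f z‖| +
          ∑ u ∈ hD.toFinset, |(D u : ℝ)| • |Real.log ‖z - u‖|) 0 R := by
        refine circleAverage_mono hgi' (hfi.add hsum) fun z _ => ?_
        refine (abs_sub _ _).trans (add_le_add le_rfl ?_)
        refine (Finset.abs_sum_le_sum_abs _ _).trans (le_of_eq ?_)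
        simp only [abs_mul, smul_eq_mul]
    _ = circleAverage (fun z => |Real.log ‖f z‖|) 0 R + ∑ u ∈ hD.toFinset,
          |(D u : ℝ)| * circleAverage (fun z => |Real.log ‖z - u‖|) 0 R := by
        rw [circleAverage_fun_add hfi hsum, circleAverage_fun_sum hterm]
        simp only [circleAverage_fun_smul]
        simp only [smul_eq_mul]
    _ ≤ circleAverage (fun z => |Real.log ‖f z‖|) 0 R + ∑ u ∈ hD.toFinset,
          |(D u : ℝ)| * (3 * Real.log 2) := by
        gcongr with u hu
        refine circleAverage_abs_log_norm_sub_le hR hR1 ?_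
        by_contra hn
        exact (by simpa using hu : D u ≠ 0)
          (Function.locallyFinsuppWithin.apply_eq_zero_of_notMem _ hn)
    _ = _ := by rw [← Finset.sum_mul]; ring

/-! ### The quantitative lemma on the logarithmic derivative -/

/-- Valid for negative `x` too, as `Real.log x = log |x|`. This matters because a pole at the origin
can make the characteristic negative. -/
theorem abs_le_exp_posLog (x : ℝ) : |x| ≤ Real.exp (log⁺ x) := by
  rcases eq_or_ne x 0 with rfl | hx
  · simp
  · rw [← Real.exp_log (abs_pos.2 hx), Real.log_abs]
    exact Real.exp_le_exp.2 (le_max_right _ _)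

/-- The arithmetic of the final estimate. With `t = exp l ≥ 1` absorbing constants, `N` is `O(t/d)`
and `2R G/(R-r)²` is `O(t/d³)`. Since `log (1+N)` counts twice, the coefficients are `3 = 1 + 2` for
`l` and `5 = 3 + 2` for `log (1/d)`. -/
theorem posLog_add_log_le_of_bounds {K₁ K₂ A N G R r d l : ℝ} (hK₁0 : 0 ≤ K₁) (hK₂0 : 0 ≤ K₂)
    (hd0 : 0 < d) (hd1 : d ≤ 1) (hR0 : 0 < R) (hR1 : R ≤ 1) (hRr : R - r = d / 4) (hl : 0 ≤ l)
    (hN0 : 0 ≤ N) (hG0 : 0 ≤ G) (hA : A ≤ 2 * Real.exp l + K₁)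
    (hN1 : N * (d / 4) ≤ 2 * Real.exp l + K₂) (hG : G ≤ A + 3 * Real.log 2 * N) :
    log⁺ (2 * R / (R - r) ^ 2 * G) + 2 * Real.log (1 + N) ≤
      Real.log (32 * (26 + K₁ + 12 * K₂)) + 2 * Real.log (9 + 4 * K₂) + 3 * l +
        5 * Real.log (1 / d) := by
  obtain ⟨t, ht⟩ : ∃ t, t = Real.exp l := ⟨_, rfl⟩
  have htl : Real.log t = l := by rw [ht, Real.log_exp]
  rw [← ht] at hA hN1
  have ht1 : 1 ≤ t := ht ▸ Real.one_le_exp hl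
  have hKt₁ : K₁ ≤ K₁ * t := le_mul_of_one_le_right hK₁0 ht1
  have hKt₂ : K₂ ≤ K₂ * t := le_mul_of_one_le_right hK₂0 ht1
  have hN : N ≤ (8 + 4 * K₂) * t / d := by
    rw [le_div_iff₀ hd0]
    linarith
  have hG2 : G ≤ (26 + K₁ + 12 * K₂) * t / d := by
    have h1 : Real.log 2 ≤ 1 := by linarith [Real.log_two_lt_d9]
    have h2 : Real.log 2 * N ≤ 1 * N := mul_le_mul_of_nonneg_right h1 hN0
    rw [le_div_iff₀ hd0]
    rw [le_div_iff₀ hd0] at hN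
    have h3 : G * d ≤ (2 * t + K₁ + 3 * N) * d :=
      mul_le_mul_of_nonneg_right (by linarith) hd0.le
    have h4 : (2 * t + K₁) * d ≤ (2 * t + K₁) * 1 :=
      mul_le_mul_of_nonneg_left hd1 (by positivity)
    linarith
  have hB : 2 * R / (R - r) ^ 2 * G ≤ 32 * (26 + K₁ + 12 * K₂) * t * (1 / d) ^ 3 := by
    have h2 : 2 * R / (R - r) ^ 2 ≤ 32 / d ^ 2 := by
      rw [hRr, div_le_div_iff₀ (by positivity) (by positivity)]
      have : 2 * R * d ^ 2 ≤ 2 * 1 * d ^ 2 := by gcongr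
      linarith
    calc _ ≤ 32 / d ^ 2 * ((26 + K₁ + 12 * K₂) * t / d) :=
          mul_le_mul h2 hG2 hG0 (by positivity)
      _ = _ := by field_simp
  have hinv : 1 ≤ 1 / d := (one_le_div hd0).2 (by linarith)
  have hlogB : log⁺ (2 * R / (R - r) ^ 2 * G) ≤
      Real.log (32 * (26 + K₁ + 12 * K₂)) + l + 3 * Real.log (1 / d) := by
    refine (Real.posLog_le_posLog (by positivity) hB).trans (le_of_eq ?_)
    rw [posLog_eq_log, Real.log_mul (by positivity) (by positivity),
      Real.log_mul (by positivity) (by positivity), htl, Real.log_pow]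
    · norm_num
    · rw [abs_of_nonneg (by positivity)]
      exact one_le_mul_of_one_le_of_one_le
        (one_le_mul_of_one_le_of_one_le (by linarith) ht1) (one_le_pow₀ hinv)
  have hlogN : Real.log (1 + N) ≤ Real.log (9 + 4 * K₂) + l + Real.log (1 / d) := by
    have h1 : 1 + N ≤ (9 + 4 * K₂) * t * (1 / d) := by
      have h2 : 1 ≤ t * (1 / d) := one_le_mul_of_one_le_of_one_le ht1 hinv
      have h3 : (8 + 4 * K₂) * t / d = (8 + 4 * K₂) * (t * (1 / d)) := by ring
      rw [h3] at hN
      linarith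
    refine (Real.log_le_log (by linarith) h1).trans (le_of_eq ?_)
    rw [Real.log_mul (by positivity) (by positivity),
      Real.log_mul (by positivity) (by positivity), htl]
  linarith

/-- A quantitative **lemma on the logarithmic derivative** in the unit disc: without an exceptional
set, at the price of evaluating the characteristic at larger radii. -/
theorem exists_proximity_logDeriv_le {f : ℂ → ℂ} (hf : MeromorphicOn f (Metric.ball 0 1))
    (hf0 : ∀ z ∈ Metric.ball (0 : ℂ) 1, meromorphicOrderAt f z ≠ ⊤) :
    ∃ K : ℝ, 0 ≤ K ∧ ∀ r : ℝ, 1 / 2 ≤ r → r < 1 →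
      proximity (logDeriv f) ⊤ r ≤ K + 3 * (log⁺ (characteristic f (1 - 3 / 4 * (1 - r))) +
        log⁺ (characteristic f (1 - 1 / 2 * (1 - r)))) + 5 * Real.log (1 / (1 - r)) := by
  obtain ⟨C, hC0, hC⟩ := exists_circleAverage_sqrt_inv_norm_sub_le
  set p : ℝ := (((meromorphicOrderAt f 0).untop₀)⁻ : ℤ) * Real.log 2 with hp
  set q : ℝ := (((meromorphicOrderAt f⁻¹ 0).untop₀)⁻ : ℤ) * Real.log 2 with hq
  set c : ℝ := |Real.log ‖meromorphicTrailingCoeffAt f 0‖| with hc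
  have hl2 : 0 ≤ Real.log 2 := Real.log_nonneg one_le_two
  have hp0 : 0 ≤ p := mul_nonneg (by exact_mod_cast negPart_nonneg _) hl2
  have hq0 : 0 ≤ q := mul_nonneg (by exact_mod_cast negPart_nonneg _) hl2
  set K₁ : ℝ := p + q + c with hK₁
  have hK₁0 : 0 ≤ K₁ := by positivity
  set K₂ : ℝ := 2 * K₁ with hK₂
  have hK₂0 : 0 ≤ K₂ := by positivity
  have hM₁ : 0 ≤ Real.log (32 * (26 + K₁ + 12 * K₂)) := Real.log_nonneg (by linarith)
  have hM₂ : 0 ≤ Real.log (9 + 4 * K₂) := Real.log_nonneg (by linarith)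
  refine ⟨Real.log (32 * (26 + K₁ + 12 * K₂)) + 2 * Real.log (9 + 4 * K₂) +
    (2 * (C * 2) + Real.log 2), by positivity, fun r hr hr1 => ?_⟩
  set d := 1 - r with hd
  -- Two intermediate radii with gaps `d/4`: the Herglotz formula is used on `|z| = R`, and the
  -- zeros and poles in `|z| ≤ R` are counted through `T(R')`.
  set R := 1 - 3 / 4 * d with hR
  set R' := 1 - 1 / 2 * d with hR'
  have hd0 : 0 < d := by linarith
  have hd1 : d ≤ 1 / 2 := by linarith
  have hR0 : 0 < R := by linarith
  have hR'0 : 0 < R' := by linarith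
  have hfR : MeromorphicOn f (Metric.closedBall 0 R) :=
    hf.mono_set (Metric.closedBall_subset_ball (by linarith))
  have hfR' : MeromorphicOn f (Metric.closedBall 0 R') :=
    hf.mono_set (Metric.closedBall_subset_ball (by linarith))
  have hfR2 : MeromorphicOn f (Metric.closedBall 0 |R|) := by rwa [abs_of_pos hR0]
  have hfR'2 : MeromorphicOn f (Metric.closedBall 0 |R'|) := by rwa [abs_of_pos hR'0]
  set D := divisor f (Metric.closedBall 0 R) with hDdef
  have hD : D.support.Finite := D.finiteSupport (isCompact_closedBall 0 R)
  obtain ⟨g, hg, hg0, hfg⟩ := hfR.extract_zeros_poles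
    (fun u => hf0 u (Metric.closedBall_subset_ball (by linarith) u.2)) hD
  have hg0' : ∀ u ∈ Metric.closedBall 0 R, g u ≠ 0 := fun u hu => hg0 ⟨u, hu⟩
  set T₁ := |characteristic f R|
  set T₂ := |characteristic f R'|
  set l := log⁺ (characteristic f R) + log⁺ (characteristic f R') with hl
  set t := Real.exp l with ht
  have ht1 : 1 ≤ t := Real.one_le_exp (add_nonneg posLog_nonneg posLog_nonneg)
  have htT₁ : T₁ ≤ t := (abs_le_exp_posLog _).trans
    (Real.exp_le_exp.2 (le_add_of_nonneg_right posLog_nonneg))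
  have htT₂ : T₂ ≤ t := (abs_le_exp_posLog _).trans
    (Real.exp_le_exp.2 (le_add_of_nonneg_left posLog_nonneg))
  have hc0 : 0 ≤ c := abs_nonneg _
  have hc1 : -Real.log ‖meromorphicTrailingCoeffAt f 0‖ ≤ c := neg_le_abs _
  set A := circleAverage (fun z => |Real.log ‖f z‖|) 0 R with hAdef
  have hA : A ≤ 2 * t + K₁ := by
    rw [hAdef, circleAverage_abs_log_norm (hfR2.mono_set Metric.sphere_subset_closedBall)]
    have h1 := proximity_le_characteristic_add (by linarith) hfR2
    have h2 := proximity_le_characteristic_add (f := f⁻¹) (by linarith) hfR2.inv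
    rw [characteristic_inv hR0.ne' hfR2] at h2
    have := le_abs_self (characteristic f R)
    linarith
  set N := ∑ u ∈ hD.toFinset, |(D u : ℝ)| with hNdef
  have hN0 : 0 ≤ N := Finset.sum_nonneg fun _ _ => abs_nonneg _
  have hN1 : N * (d / 4) ≤ 2 * t + K₂ := by
    have h1 := sum_negPart_divisor_mul_log_le (by linarith) (by linarith) (by linarith) hfR'
      hD.toFinset (r := R)
    have h2 := sum_negPart_divisor_mul_log_le (f := f⁻¹) (by linarith) (by linarith) (by linarith)
      hfR'.inv hD.toFinset (r := R)
    rw [characteristic_inv hR'0.ne' hfR'2] at h2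
    -- The total multiplicity is the number of poles of `f` plus that of `f⁻¹`.
    have h3 : N = (∑ z ∈ hD.toFinset, ((divisor f (Metric.closedBall 0 R))⁻ z : ℝ)) +
        ∑ z ∈ hD.toFinset, ((divisor f⁻¹ (Metric.closedBall 0 R))⁻ z : ℝ) := by
      rw [← Finset.sum_add_distrib]
      refine Finset.sum_congr rfl fun z _ => ?_
      rw [divisor_inv, ← hDdef, ← Int.cast_abs, ← Int.cast_add,
        Function.locallyFinsuppWithin.negPart_apply, Function.locallyFinsuppWithin.negPart_apply,
        Function.locallyFinsuppWithin.coe_neg, Pi.neg_apply, negPart_neg, add_comm,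
        posPart_add_negPart]
    -- `log x ≥ 1 - 1/x` gives `(R'-R)/R'`, and `R' ≤ 1`.
    have h4 : d / 4 ≤ Real.log (R' / R) := by
      have h5 := Real.one_sub_inv_le_log_of_pos (div_pos hR'0 hR0)
      refine le_trans ?_ h5
      rw [inv_div, one_sub_div hR'0.ne', le_div_iff₀ hR'0]
      nlinarith
    have h6 := mul_le_mul_of_nonneg_left h4 hN0
    have := le_abs_self (characteristic f R')
    refine h6.trans ?_
    rw [h3, add_mul]
    linarith
  set G := circleAverage (fun z => |Real.log ‖g z‖|) 0 R with hGdef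
  have hG : G ≤ A + 3 * Real.log 2 * N :=
    circleAverage_abs_log_norm_le_of_factorization (by linarith) (by linarith) hD hfR hg0' hg hfg
  have hmain := proximity_logDeriv_le_of_factorization hD hfR hg hg0' hfg (by linarith : 0 < r)
    (by linarith) (C := C * 2) (fun a => by
      refine ⟨(hC r (by linarith) a).1, (hC r (by linarith) a).2.trans ?_⟩
      refine mul_le_mul_of_nonneg_left ?_ hC0
      rw [Real.sqrt_le_left (by norm_num)]
      calc r⁻¹ ≤ (1 / 2)⁻¹ := inv_anti₀ (by norm_num) hr
        _ ≤ 2 ^ 2 := by norm_num)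
  have hnum := posLog_add_log_le_of_bounds (l := l) hK₁0 hK₂0 hd0 (by linarith) hR0 (by linarith)
    (by rw [hR, hd]; ring : R - r = d / 4) (add_nonneg posLog_nonneg posLog_nonneg) hN0
    (circleAverage_nonneg_of_nonneg fun _ _ => abs_nonneg _) hA hN1 hG
  linarith

/-! ### The characteristic of the derivative -/

/-- A pole of order `n ≥ 1` becomes one of order `n + 1 ≤ 2n`, and no new poles appear. -/
theorem untop₀_negPart_deriv_le {f : ℂ → ℂ} {z : ℂ} (hf : MeromorphicAt f z) :
    ((meromorphicOrderAt (deriv f) z).untop₀)⁻ ≤ 2 * ((meromorphicOrderAt f z).untop₀)⁻ := by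
  by_cases hnonneg : 0 ≤ meromorphicOrderAt f z
  · have h1 : 0 ≤ meromorphicOrderAt (deriv f) z := by
      obtain ⟨g, hg, hfg⟩ := hf.meromorphicOrderAt_nonneg_iff.1 hnonneg
      rw [meromorphicOrderAt_congr hfg.nhdsNE_deriv]
      exact hg.deriv.meromorphicOrderAt_nonneg
    have h2 : 0 ≤ (meromorphicOrderAt (deriv f) z).untop₀ := by simpa using h1
    rw [negPart_eq_zero.2 h2]
    have := negPart_nonneg (meromorphicOrderAt f z).untop₀
    linarith
  · obtain ⟨n, hn⟩ := WithTop.ne_top_iff_exists.1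
      (fun h => hnonneg (h ▸ le_top) : meromorphicOrderAt f z ≠ ⊤)
    have hn0 : n < 0 := by
      rw [← hn] at hnonneg
      exact not_le.1 fun h => hnonneg (by exact_mod_cast h)
    rw [meromorphicOrderAt_deriv_eq_sub_one (n := n) (by exact_mod_cast hn0.ne) hn.symm, ← hn]
    simp only [WithTop.untop₀_coe]
    rw [negPart_eq_neg.2 (by omega), negPart_eq_neg.2 hn0.le]
    omega

theorem sphere_subset_ball {r : ℝ} (hr : |r| < 1) : Metric.sphere (0 : ℂ) |r| ⊆ Metric.ball 0 1 :=
  Metric.sphere_subset_closedBall.trans (Metric.closedBall_subset_ball hr)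

/-- Off the zeros of `g` the quotient is `(f/g)(g/h)`, and `log⁺` is subadditive on products. This
is the telescoping step for higher derivatives. -/
theorem proximity_div_comp_le {f g h : ℂ → ℂ} (hf : MeromorphicOn f (Metric.ball 0 1))
    (hg : MeromorphicOn g (Metric.ball 0 1)) (hh : MeromorphicOn h (Metric.ball 0 1))
    (hg0 : ∀ z ∈ Metric.ball (0 : ℂ) 1, meromorphicOrderAt g z ≠ ⊤) {r : ℝ} (hr : 0 < r)
    (hr1 : r < 1) :
    proximity (f / h) ⊤ r ≤ proximity (f / g) ⊤ r + proximity (g / h) ⊤ r := by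
  have hss := sphere_subset_ball (r := r) (by rwa [abs_of_pos hr])
  have hfg := (hf.div hg).mono_set hss
  have hgh := (hg.div hh).mono_set hss
  have heq : f / h =ᶠ[codiscreteWithin (Metric.sphere 0 |r|)] (f / g) * (g / h) := by
    filter_upwards [(hg.eventually_codiscreteWithin_apply_ne_zero hg0).filter_mono
      (codiscreteWithin_mono hss)] with z hz
    simp only [Pi.div_apply, Pi.mul_apply]
    rw [div_mul_div_cancel₀ hz]
  rw [proximity_congr_codiscreteWithin heq hr.ne', proximity_top, proximity_top, proximity_top,
    ← circleAverage_fun_add hfg.circleIntegrable_posLog_norm hgh.circleIntegrable_posLog_norm]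
  refine circleAverage_mono (hfg.mul hgh).circleIntegrable_posLog_norm
    (hfg.circleIntegrable_posLog_norm.add hgh.circleIntegrable_posLog_norm) fun z _ => ?_
  rw [Pi.mul_apply, norm_mul]
  exact posLog_mul

/-- Here `m(f') ≤ m(f'/f) + m(f)`, and `N(f') ≤ 2N(f)` up to the terms at the origin, which `K`
absorbs. -/
theorem exists_abs_characteristic_deriv_le {f : ℂ → ℂ} (hf : MeromorphicOn f (Metric.ball 0 1))
    (hf0 : ∀ z ∈ Metric.ball (0 : ℂ) 1, meromorphicOrderAt f z ≠ ⊤) :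
    ∃ K : ℝ, 0 ≤ K ∧ ∀ r : ℝ, 1 / 2 ≤ r → r < 1 →
      |characteristic (deriv f) r| ≤
        2 * |characteristic f r| + proximity (logDeriv f) ⊤ r + K := by
  have hl2 : 0 ≤ Real.log 2 := Real.log_nonneg one_le_two
  set p : ℝ := ((((meromorphicOrderAt f 0).untop₀)⁻ : ℤ) : ℝ) with hp
  set p' : ℝ := ((((meromorphicOrderAt (deriv f) 0).untop₀)⁻ : ℤ) : ℝ) with hp'
  have hp0 : 0 ≤ p := by rw [hp]; exact_mod_cast negPart_nonneg _
  have hp'0 : 0 ≤ p' := by rw [hp']; exact_mod_cast negPart_nonneg _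
  refine ⟨2 * p * Real.log 2 + p' * Real.log 2, by positivity, fun r hr hr1 => ?_⟩
  have hr0 : 0 < r := by linarith
  have hsub : Metric.closedBall (0 : ℂ) |r| ⊆ Metric.ball 0 1 :=
    Metric.closedBall_subset_ball (by rwa [abs_of_pos hr0])
  have hfr := hf.mono_set hsub
  have hfr' := hf.deriv.mono_set hsub
  set D := divisor f (Metric.closedBall 0 |r|) with hD
  set D' := divisor (deriv f) (Metric.closedBall 0 |r|) with hD'
  have hfin := D.finiteSupport (isCompact_closedBall 0 |r|)
  have hfin' := D'.finiteSupport (isCompact_closedBall 0 |r|)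
  have hN := logCounting_eq_sum (f := f) (r := r) (s := hfin.toFinset ∪ hfin'.toFinset)
    (by simp [← hD])
  have hN' := logCounting_eq_sum (f := deriv f) (r := r) (s := hfin.toFinset ∪ hfin'.toFinset)
    (by simp [← hD'])
  set S := ∑ z ∈ hfin.toFinset ∪ hfin'.toFinset, (D⁻ z : ℝ) * Real.log (r * ‖z‖⁻¹) with hS
  set S' := ∑ z ∈ hfin.toFinset ∪ hfin'.toFinset, (D'⁻ z : ℝ) * Real.log (r * ‖z‖⁻¹) with hS'
  have hS0 : 0 ≤ S := Finset.sum_nonneg fun z _ => log_radius_div_nonneg z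
  have hS'0 : 0 ≤ S' := Finset.sum_nonneg fun z _ => log_radius_div_nonneg z
  have hSS' : S' ≤ 2 * S := by
    rw [hS, hS', Finset.mul_sum]
    refine Finset.sum_le_sum fun z _ => ?_
    by_cases hz : z ∈ Metric.closedBall (0 : ℂ) |r|
    · rw [hD, hD', negPart_divisor_apply hfr hz, negPart_divisor_apply hfr' hz, ← mul_assoc]
      refine mul_le_mul_of_nonneg_right
        (by exact_mod_cast untop₀_negPart_deriv_le (hfr z hz)) ?_
      rcases eq_or_ne z 0 with rfl | hz0
      · simp
      refine Real.log_nonneg ?_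
      rw [← div_eq_mul_inv, one_le_div (norm_pos_iff.2 hz0)]
      simpa [abs_of_pos hr0] using hz
    · simp [Function.locallyFinsuppWithin.apply_eq_zero_of_notMem _ hz]
  rw [← hD, show (D⁻ 0 : ℝ) = p by rw [hD, negPart_divisor_apply hfr (by simp)]] at hN
  rw [← hD', show (D'⁻ 0 : ℝ) = p' by rw [hD', negPart_divisor_apply hfr' (by simp)]] at hN'
  have hprox : proximity (deriv f) ⊤ r ≤ proximity (logDeriv f) ⊤ r + proximity f ⊤ r := by
    have := proximity_div_comp_le hf.deriv hf (fun z _ => analyticAt_const.meromorphicAt) hf0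
      hr0 hr1 (h := fun _ => (1 : ℂ))
    rw [show deriv f / (fun _ => (1 : ℂ)) = deriv f by ext; simp,
      show f / (fun _ => (1 : ℂ)) = f by ext; simp] at this
    exact this
  have hm := proximity_nonneg (f := f) (a := ⊤) r
  have hm' := proximity_nonneg (f := deriv f) (a := ⊤) r
  have hq := proximity_nonneg (f := logDeriv f) (a := ⊤) r
  simp only [Pi.zero_apply] at hm hm' hq
  have hlr : Real.log r ≤ 0 := Real.log_nonpos hr0.le hr1.le
  have hlr' : -Real.log 2 ≤ Real.log r := by
    rw [← Real.log_inv]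
    exact Real.log_le_log (by norm_num) (by linarith)
  have h1 : -(p * Real.log 2) ≤ p * Real.log r := by
    have := mul_le_mul_of_nonneg_left hlr' hp0
    linarith
  have h2 : -(p' * Real.log 2) ≤ p' * Real.log r := by
    have := mul_le_mul_of_nonneg_left hlr' hp'0
    linarith
  have h3 : p' * Real.log r ≤ 0 := mul_nonpos_of_nonneg_of_nonpos hp'0 hlr
  have h4 := le_abs_self (characteristic f r)
  have h5 := abs_nonneg (characteristic f r)
  have h6 : characteristic f r = proximity f ⊤ r + (S + p * Real.log r) := by
    rw [characteristic, hN]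
  have h7 : 0 ≤ p * Real.log 2 := mul_nonneg hp0 hl2
  have h8 : 0 ≤ p' * Real.log 2 := mul_nonneg hp'0 hl2
  rw [characteristic, hN', abs_le]
  constructor <;> linarith

end UnitDisc

end

/-! ### The growth scale and its stability -/

namespace UnitDisc

open ValueDistribution Real

/-- The majorant `exp (α⁻¹ (s β (log γ (1 / (1 - r)))))`. -/
noncomputable def growthMajorant (α β γ : ℝ → ℝ) (s r : ℝ) : ℝ :=
  Real.exp (inv α (s * β (Real.log (γ (1 / (1 - r))))))

theorem ClassL.bddAbove {a : ℝ → ℝ} (ha : ClassL a) (y : ℝ) : BddAbove {x | a x ≤ y} := by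
  obtain ⟨M, hM⟩ := eventually_atTop.1 (ha.tendsto_atTop.eventually_gt_atTop y)
  refine ⟨M, fun z hz => ?_⟩
  by_contra h
  exact absurd (hM z (not_le.1 h).le) (not_lt.2 hz)

theorem ClassL.le_inv {a : ℝ → ℝ} (ha : ClassL a) {x y : ℝ} (h : a x ≤ y) : x ≤ inv a y :=
  le_csSup (ha.bddAbove y) h

theorem ClassL.inv_le_inv {a : ℝ → ℝ} (ha : ClassL a) {x y z : ℝ} (hx : a x ≤ y) (hyz : y ≤ z) :
    inv a y ≤ inv a z :=
  csSup_le_csSup (ha.bddAbove z) ⟨x, hx⟩ fun _ h => le_trans h hyz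

theorem ClassL.exists_monotoneOn {a : ℝ → ℝ} (ha : ClassL a) : ∃ x₀, MonotoneOn a (Ici x₀) :=
  let ⟨x₀, _, h⟩ := ha.exists_base
  ⟨x₀, h⟩

theorem tendsto_one_div_one_sub_atTop : Tendsto (fun r : ℝ => 1 / (1 - r)) (𝓝[<] 1) atTop := by
  simp only [one_div]
  refine tendsto_inv_nhdsGT_zero.comp (tendsto_nhdsWithin_iff.2 ⟨?_, ?_⟩)
  · have : Tendsto (fun r : ℝ => 1 - r) (𝓝 1) (𝓝 (1 - 1)) := tendsto_const_nhds.sub tendsto_id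
    rw [sub_self] at this
    exact this.mono_left nhdsWithin_le_nhds
  · filter_upwards [self_mem_nhdsWithin] with r hr using mem_Ioi.2 (sub_pos.2 (mem_Iio.1 hr))

variable {α β γ : ℝ → ℝ}

theorem Admissible.tendsto_log_gamma (h : Admissible α β γ) :
    Tendsto (fun x => Real.log (γ x)) atTop atTop :=
  Real.tendsto_log_atTop.comp h.gamma.tendsto_atTop

theorem Admissible.tendsto_beta (h : Admissible α β γ) :
    Tendsto (fun x => β (Real.log (γ x))) atTop atTop :=
  h.beta.tendsto_atTop.comp h.tendsto_log_gamma

/-- Comparison of the values of `β (log γ)` at comparable arguments. -/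
theorem Admissible.eventually_beta_le (h : Admissible α β γ) {c : ℝ} (hc : 1 < c) :
    ∀ᶠ x in atTop, ∀ y, x ≤ y → y ≤ 2 * x →
      β (Real.log (γ y)) ≤ c * β (Real.log (γ x)) := by
  obtain ⟨x₁, hγ⟩ := h.gamma.exists_monotoneOn
  obtain ⟨x₂, hβ⟩ := h.beta.exists_monotoneOn
  obtain ⟨R₀, hR₀⟩ := h.gamma.subadditive
  -- Subadditivity gives `γ(2x) ≤ 2γ(x)`, so `log γ` moves by at most `log 2`, a bounded shift that
  -- `β` tolerates.
  have hshift : ∀ᶠ u in atTop, β (u + Real.log 2) ≤ c * β u := by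
    have h1 := (h.beta.equivalent_shift (fun _ => Real.log 2) (isBigO_const_const _ one_ne_zero _))
    have h2 := h1.isLittleO.bound (sub_pos.2 hc)
    filter_upwards [h2] with u hu
    simp only [Pi.sub_apply, Real.norm_eq_abs, abs_of_nonneg (h.beta.nonneg u)] at hu
    have := le_abs_self (β (u + Real.log 2) - β u)
    linarith
  filter_upwards [eventually_ge_atTop x₁, eventually_ge_atTop R₀, eventually_ge_atTop 0,
    h.tendsto_log_gamma.eventually (eventually_ge_atTop x₂), h.tendsto_log_gamma.eventually hshift,
    h.gamma.tendsto_atTop.eventually_gt_atTop 0] with x hx1 hx2 hx3 hx4 hx5 hx6 y hxy hy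
  have h1 : γ y ≤ 2 * γ x := by
    have h2 := hR₀ x hx2 x hx2
    have h3 := hγ (mem_Ici.2 (hx1.trans hxy)) (mem_Ici.2 (by linarith : x₁ ≤ 2 * x)) hy
    rw [two_mul] at h3
    linarith
  have h2 : γ x ≤ γ y := hγ hx1 (mem_Ici.2 (hx1.trans hxy)) hxy
  have h3 : Real.log (γ x) ≤ Real.log (γ y) := Real.log_le_log hx6 h2
  have h4 : Real.log (γ y) ≤ Real.log (γ x) + Real.log 2 := by
    rw [← Real.log_mul hx6.ne' two_ne_zero]
    exact Real.log_le_log (hx6.trans_le h2) (by linarith)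
  exact (hβ (mem_Ici.2 (hx4.trans h3)) (mem_Ici.2 (hx4.trans (h3.trans h4))) h4).trans hx5

/-- Shrinking `1-r` by `c` at most doubles `1/(1-r)`, so `β(log γ)` gains at most the factor `s'/s >
1`. -/
theorem Admissible.eventually_growthMajorant_le (h : Admissible α β γ) {s s' : ℝ} (hs : 0 < s)
    (hss' : s < s') : ∀ᶠ r in 𝓝[<] (1 : ℝ), ∀ c, 1 / 2 ≤ c → c ≤ 1 →
      growthMajorant α β γ s (1 - c * (1 - r)) ≤ growthMajorant α β γ s' r := by
  have hc : 1 < s' / s := (one_lt_div hs).2 hss'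
  -- Monotonicity of the supremum `inv α` needs a nonempty sublevel set; `0` is a member once the
  -- level exceeds `α 0`.
  have hlarge : ∀ᶠ x in atTop, ∀ y, x ≤ y → α 0 ≤ s * β (Real.log (γ y)) := by
    obtain ⟨X, hX⟩ := eventually_atTop.1
      ((h.tendsto_beta.const_mul_atTop hs).eventually_ge_atTop (α 0))
    filter_upwards [eventually_ge_atTop X] with x hx y hxy using hX y (hx.trans hxy)
  filter_upwards [tendsto_one_div_one_sub_atTop.eventually (h.eventually_beta_le hc),
    tendsto_one_div_one_sub_atTop.eventually hlarge, self_mem_nhdsWithin] with r hr1 hr2 hr c hc1 hc2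
  have hd : 0 < 1 - r := sub_pos.2 hr
  have hc0 : 0 < c := by linarith
  have h1 : 1 / (1 - r) ≤ 1 / (1 - (1 - c * (1 - r))) := by
    rw [sub_sub_cancel]
    exact one_div_le_one_div_of_le (by positivity) (mul_le_of_le_one_left hd.le hc2)
  have h2 : 1 / (1 - (1 - c * (1 - r))) ≤ 2 * (1 / (1 - r)) := by
    rw [sub_sub_cancel, mul_one_div, div_le_div_iff₀ (by positivity) hd]
    nlinarith
  refine Real.exp_le_exp.2 (h.alpha.inv_le_inv (hr2 _ h1) ?_)
  calc _ ≤ s * (s' / s * β (Real.log (γ (1 / (1 - r))))) :=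
        mul_le_mul_of_nonneg_left (hr1 _ h1 h2) hs.le
    _ = _ := by field_simp

/-- This is the hypothesis on iterated logarithms at `p = 2`, with `s` as the constant in the
little-o. -/
theorem Admissible.eventually_log_le_growthMajorant (h : Admissible α β γ) {s : ℝ} (hs : 0 < s) :
    ∀ᶠ r in 𝓝[<] (1 : ℝ), Real.log (1 / (1 - r)) ≤ growthMajorant α β γ s r := by
  have h1 := (h.alpha_log_iter 2 le_rfl).bound hs
  filter_upwards [tendsto_one_div_one_sub_atTop.eventually h1,
    (Real.tendsto_log_atTop.comp tendsto_one_div_one_sub_atTop).eventually_gt_atTop 0]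
    with r hr hr0
  simp only [Real.norm_eq_abs, abs_of_nonneg (h.alpha.nonneg _), abs_of_nonneg (h.beta.nonneg _),
    Function.iterate_succ, Function.iterate_zero, Function.comp_apply, id] at hr hr0
  rw [← Real.exp_log hr0]
  exact Real.exp_le_exp.2 (h.alpha.le_inv hr)

theorem Admissible.one_isBigO_growthMajorant (h : Admissible α β γ) {s : ℝ} (hs : 0 < s) :
    (fun _ => (1 : ℝ)) =O[𝓝[<] (1 : ℝ)] growthMajorant α β γ s := by
  refine IsBigO.of_bound 1 ?_
  filter_upwards [h.eventually_log_le_growthMajorant hs,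
    (Real.tendsto_log_atTop.comp tendsto_one_div_one_sub_atTop).eventually_ge_atTop 1]
    with r hr hr0
  rw [norm_one, one_mul]
  exact (hr0.trans hr).trans (le_abs_self _)

theorem Admissible.log_isBigO_growthMajorant (h : Admissible α β γ) {s : ℝ} (hs : 0 < s) :
    (fun r => Real.log (1 / (1 - r))) =O[𝓝[<] (1 : ℝ)] growthMajorant α β γ s := by
  refine IsBigO.of_bound 1 ?_
  filter_upwards [h.eventually_log_le_growthMajorant hs,
    (Real.tendsto_log_atTop.comp tendsto_one_div_one_sub_atTop).eventually_ge_atTop 0]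
    with r hr hr0
  rw [one_mul, Real.norm_of_nonneg (by simpa using hr0)]
  exact hr.trans (le_abs_self _)

theorem tendsto_one_sub_mul {c : ℝ} (hc : 0 < c) :
    Tendsto (fun r : ℝ => 1 - c * (1 - r)) (𝓝[<] 1) (𝓝[<] 1) := by
  refine tendsto_nhdsWithin_iff.2 ⟨?_, ?_⟩
  · have : Tendsto (fun r : ℝ => 1 - c * (1 - r)) (𝓝 1) (𝓝 (1 - c * (1 - 1))) :=
      (by fun_prop : Continuous fun r : ℝ => 1 - c * (1 - r)).tendsto 1
    simp only [sub_self, mul_zero, sub_zero] at this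
    exact this.mono_left nhdsWithin_le_nhds
  · filter_upwards [self_mem_nhdsWithin] with r hr
    have : 0 < c * (1 - r) := mul_pos hc (sub_pos.2 hr)
    simpa using this

/-- A function dominated by all the majorants with parameter `> ϱ` is still dominated by them after
replacing `1 - r` by `c (1 - r)`, where `1 / 2 ≤ c ≤ 1`. -/
theorem Admissible.isBigO_comp_one_sub_mul (h : Admissible α β γ) {ϱ : ℝ} (hϱ : 0 ≤ ϱ) {u : ℝ → ℝ}
    (hu : ∀ s > ϱ, u =O[𝓝[<] (1 : ℝ)] growthMajorant α β γ s) {c : ℝ} (hc1 : 1 / 2 ≤ c)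
    (hc2 : c ≤ 1) {s : ℝ} (hs : ϱ < s) :
    (fun r => u (1 - c * (1 - r))) =O[𝓝[<] (1 : ℝ)] growthMajorant α β γ s := by
  -- The gap between `s₁` and `s` pays for the change of radius.
  obtain ⟨s₁, hs₁, hs₁s⟩ := exists_between hs
  refine ((hu s₁ hs₁).comp_tendsto (tendsto_one_sub_mul (by linarith : 0 < c))).trans
    (IsBigO.of_bound 1 ?_)
  filter_upwards [h.eventually_growthMajorant_le (hϱ.trans_lt hs₁) hs₁s] with r hr
  rw [one_mul]
  simpa only [Function.comp_apply, growthMajorant, Real.norm_eq_abs, Real.abs_exp]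
    using hr c hc1 hc2

theorem logOrder_nonneg (h : Admissible α β γ) (f : ℂ → ℂ) : 0 ≤ logOrder α β γ f := by
  refine le_limsup_of_frequently_le (Frequently.of_forall fun r => ?_)
  exact_mod_cast div_nonneg (h.alpha.nonneg _) (h.beta.nonneg _)

/-- Near `1` the order gives `α(log log T) ≤ s β(log γ)`; apply `α⁻¹` and exponentiate once. -/
theorem Admissible.posLog_characteristic_isBigO (h : Admissible α β γ) {f : ℂ → ℂ} {ϱ : ℝ}
    (hϱ : logOrder α β γ f = (ϱ : EReal)) {s : ℝ} (hs : ϱ < s) :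
    (fun r => Real.posLog (characteristic f r)) =O[𝓝[<] (1 : ℝ)] growthMajorant α β γ s := by
  have hlim : logOrder α β γ f < (s : EReal) := by rw [hϱ]; exact_mod_cast hs
  refine IsBigO.of_bound 1 ?_
  filter_upwards [eventually_lt_of_limsup_lt hlim,
    (h.tendsto_beta.comp tendsto_one_div_one_sub_atTop).eventually_gt_atTop 0] with r hr hr0
  have h1 := EReal.coe_lt_coe_iff.1 hr
  have h2 := h.alpha.le_inv ((div_lt_iff₀ hr0).1 h1).le
  rw [Real.norm_of_nonneg posLog_nonneg, one_mul]
  refine le_trans ?_ (le_abs_self _)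
  refine le_trans ?_ (Real.exp_le_exp.2 h2)
  rcases (posLog_nonneg (x := characteristic f r)).eq_or_lt with h0 | h0
  · rw [← h0]; exact (Real.exp_pos _).le
  · conv_lhs => rw [← Real.exp_log h0]
    exact Real.exp_le_exp.2 (le_max_right _ _)

/-! ### Higher derivatives and conclusion -/

theorem meromorphicOn_iteratedDeriv {f : ℂ → ℂ} {U : Set ℂ} (hf : MeromorphicOn f U) (k : ℕ) :
    MeromorphicOn (iteratedDeriv k f) U := by
  rw [iteratedDeriv_eq_iterate]
  exact hf.iterated_deriv

theorem meromorphicOrderAt_deriv_eq_top {f : ℂ → ℂ} {z : ℂ} (hf : meromorphicOrderAt f z = ⊤) :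
    meromorphicOrderAt (deriv f) z = ⊤ := by
  have h1 : deriv f =ᶠ[𝓝[≠] z] deriv fun _ => 0 :=
    EventuallyEq.nhdsNE_deriv (meromorphicOrderAt_eq_top_iff.1 hf)
  rw [meromorphicOrderAt_eq_top_iff]
  filter_upwards [h1] with w hw
  rw [hw, deriv_const]

theorem proximity_div_eq_zero {f g : ℂ → ℂ}
    (hg : ∀ z ∈ Metric.ball (0 : ℂ) 1, meromorphicOrderAt g z = ⊤) {r : ℝ} (hr : 0 < r)
    (hr1 : r < 1) : proximity (g / f) ⊤ r = 0 := by
  have hss := sphere_subset_ball (r := r) (by rwa [abs_of_pos hr])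
  have heq : g / f =ᶠ[codiscreteWithin (Metric.sphere 0 |r|)] fun _ => 0 := by
    rw [EventuallyEq, Filter.Eventually, mem_codiscreteWithin_iff_forall_mem_nhdsNE]
    intro z hz
    filter_upwards [meromorphicOrderAt_eq_top_iff.1 (hg z (hss hz))] with w hw
    exact Or.inl (by simp [hw])
  rw [proximity_congr_codiscreteWithin heq hr.ne', proximity_const, norm_zero]
  simp [posLog_apply]

theorem eventually_mem_Ico : ∀ᶠ r in 𝓝[<] (1 : ℝ), r ∈ Ico (1 / 2 : ℝ) 1 :=
  Ico_mem_nhdsLT (by norm_num)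

/-- The growth of `T` is assumed for all `s > ϱ` at once, because larger radii use up part of the
parameter; in this form the bound passes from each derivative to the next. -/
theorem Admissible.proximity_logDeriv_isBigO (h : Admissible α β γ) {ϱ : ℝ} (hϱ : 0 ≤ ϱ)
    {f : ℂ → ℂ} (hf : MeromorphicOn f (Metric.ball 0 1))
    (hf0 : ∀ z ∈ Metric.ball (0 : ℂ) 1, meromorphicOrderAt f z ≠ ⊤)
    (hT : ∀ s > ϱ, (fun r => log⁺ (characteristic f r)) =O[𝓝[<] (1 : ℝ)] growthMajorant α β γ s)
    {s : ℝ} (hs : ϱ < s) :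
    proximity (logDeriv f) ⊤ =O[𝓝[<] (1 : ℝ)] growthMajorant α β γ s := by
  obtain ⟨K, hK0, hK⟩ := exists_proximity_logDeriv_le hf hf0
  have hs0 : 0 < s := hϱ.trans_lt hs
  have h1 := h.isBigO_comp_one_sub_mul hϱ hT (c := 3 / 4) (by norm_num) (by norm_num) hs
  have h2 := h.isBigO_comp_one_sub_mul hϱ hT (c := 1 / 2) (by norm_num) (by norm_num) hs
  have h3 := (h.one_isBigO_growthMajorant hs0).const_mul_left K
  have h4 := (h.log_isBigO_growthMajorant hs0).const_mul_left 5
  refine IsBigO.trans (IsBigO.of_bound 1 ?_) ((h3.add ((h1.add h2).const_mul_left 3)).add h4)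
  filter_upwards [eventually_mem_Ico] with r hr
  rw [one_mul, Real.norm_of_nonneg (proximity_nonneg r), mul_one]
  exact (hK r hr.1 hr.2).trans (le_abs_self _)

/-- The crude `log⁺ m ≤ m` suffices, as `m(r, f'/f)` is itself within the majorant. -/
theorem Admissible.posLog_characteristic_deriv_isBigO (h : Admissible α β γ) {ϱ : ℝ} (hϱ : 0 ≤ ϱ)
    {f : ℂ → ℂ} (hf : MeromorphicOn f (Metric.ball 0 1))
    (hf0 : ∀ z ∈ Metric.ball (0 : ℂ) 1, meromorphicOrderAt f z ≠ ⊤)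
    (hT : ∀ s > ϱ, (fun r => log⁺ (characteristic f r)) =O[𝓝[<] (1 : ℝ)] growthMajorant α β γ s)
    {s : ℝ} (hs : ϱ < s) :
    (fun r => log⁺ (characteristic (deriv f) r)) =O[𝓝[<] (1 : ℝ)] growthMajorant α β γ s := by
  obtain ⟨K, hK0, hK⟩ := exists_abs_characteristic_deriv_le hf hf0
  have h1 := h.proximity_logDeriv_isBigO hϱ hf hf0 hT hs
  have h2 := (h.one_isBigO_growthMajorant (hϱ.trans_lt hs)).const_mul_left (3 * Real.log 2 + K)
  refine IsBigO.trans (IsBigO.of_bound 1 ?_) (((hT s hs).add h1).add h2)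
  filter_upwards [eventually_mem_Ico] with r hr
  have hq : 0 ≤ proximity (logDeriv f) ⊤ r := proximity_nonneg r
  have hle : ∀ x : ℝ, 0 ≤ x → log⁺ x ≤ x := fun x hx => by
    rw [posLog_apply]
    exact max_le hx (Real.log_le_self hx)
  rw [one_mul, Real.norm_of_nonneg posLog_nonneg, mul_one, ← posLog_abs]
  refine le_trans ?_ (le_abs_self _)
  have h3 := posLog_le_posLog (abs_nonneg _) (hK r hr.1 hr.2)
  have h4 := posLog_add (x := 2 * |characteristic f r| + proximity (logDeriv f) ⊤ r) (y := K)
  have h5 := posLog_add (x := 2 * |characteristic f r|) (y := proximity (logDeriv f) ⊤ r)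
  have h6 := posLog_nat_mul (n := 2) (x := |characteristic f r|)
  rw [posLog_abs, Nat.cast_ofNat] at h6
  have h7 := hle _ hq
  have h8 := hle _ hK0
  linarith

/-- Either the `k`-th derivative vanishes identically, or its characteristic grows at most like that
of the function. -/
theorem Admissible.iteratedDeriv_eq_top_or_isBigO (h : Admissible α β γ) {ϱ : ℝ} (hϱ : 0 ≤ ϱ)
    {f : ℂ → ℂ} (hf : MeromorphicOn f (Metric.ball 0 1))
    (hT : ∀ s > ϱ, (fun r => log⁺ (characteristic f r)) =O[𝓝[<] (1 : ℝ)] growthMajorant α β γ s)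
    (k : ℕ) :
    (∀ z ∈ Metric.ball (0 : ℂ) 1, meromorphicOrderAt (iteratedDeriv k f) z = ⊤) ∨
      ((∀ z ∈ Metric.ball (0 : ℂ) 1, meromorphicOrderAt (iteratedDeriv k f) z ≠ ⊤) ∧
        ∀ s > ϱ, (fun r => log⁺ (characteristic (iteratedDeriv k f) r)) =O[𝓝[<] (1 : ℝ)]
          growthMajorant α β γ s) := by
  have hconn : IsConnected (Metric.ball (0 : ℂ) 1) := Metric.isConnected_ball one_pos
  -- Identity theorem on the connected disc.
  have hdich : ∀ k, (∀ z ∈ Metric.ball (0 : ℂ) 1, meromorphicOrderAt (iteratedDeriv k f) z = ⊤) ∨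
      ∀ z ∈ Metric.ball (0 : ℂ) 1, meromorphicOrderAt (iteratedDeriv k f) z ≠ ⊤ := fun k => by
    have := (meromorphicOn_iteratedDeriv hf k).exists_meromorphicOrderAt_ne_top_iff_forall_mem hconn
    rw [← this]
    by_cases hex : ∃ u ∈ Metric.ball (0 : ℂ) 1, meromorphicOrderAt (iteratedDeriv k f) u ≠ ⊤
    · exact Or.inr hex
    · push Not at hex
      exact Or.inl hex
  induction k with
  | zero => exact (hdich 0).imp_right fun h0 => ⟨h0, by simpa using hT⟩
  | succ k ih =>
    refine (hdich (k + 1)).imp_right fun h0 => ⟨h0, ?_⟩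
    rcases ih with ih | ⟨ih0, ih⟩
    · refine absurd ?_ (h0 0 (by simp))
      rw [iteratedDeriv_succ]
      exact meromorphicOrderAt_deriv_eq_top (ih 0 (by simp))
    · intro s hs
      rw [iteratedDeriv_succ]
      exact h.posLog_characteristic_deriv_isBigO hϱ (meromorphicOn_iteratedDeriv hf k) ih0 ih hs

theorem Admissible.proximity_iteratedDeriv_div_isBigO (h : Admissible α β γ) {ϱ : ℝ} (hϱ : 0 ≤ ϱ)
    {f : ℂ → ℂ} (hf : MeromorphicOn f (Metric.ball 0 1))
    (hT : ∀ s > ϱ, (fun r => log⁺ (characteristic f r)) =O[𝓝[<] (1 : ℝ)] growthMajorant α β γ s)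
    {s : ℝ} (hs : ϱ < s) (k : ℕ) :
    proximity (iteratedDeriv k f / f) ⊤ =O[𝓝[<] (1 : ℝ)] growthMajorant α β γ s := by
  induction k with
  | zero =>
    -- `f/f` takes only the values `0` and `1`, so its `log⁺` vanishes everywhere.
    have hz : proximity (iteratedDeriv 0 f / f) ⊤ = fun _ => 0 := by
      rw [iteratedDeriv_zero, proximity_top]
      ext r
      have : (fun z => log⁺ ‖(f / f) z‖) = fun _ => 0 := by
        ext z
        rw [posLog_eq_zero_iff, abs_norm, Pi.div_apply]
        rcases eq_or_ne (f z) 0 with h0 | h0 <;> simp [h0]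
      rw [this, circleAverage_const]
    rw [hz]
    exact isBigO_zero _ _
  | succ k ih =>
    have hk := meromorphicOn_iteratedDeriv hf k
    rw [iteratedDeriv_succ]
    rcases h.iteratedDeriv_eq_top_or_isBigO hϱ hf hT k with htop | ⟨hk0, hkT⟩
    · refine (isBigO_zero (growthMajorant α β γ s) (𝓝[<] (1 : ℝ))).congr' ?_ EventuallyEq.rfl
      filter_upwards [eventually_mem_Ico] with r hr
      exact (proximity_div_eq_zero (fun z hz => meromorphicOrderAt_deriv_eq_top (htop z hz))
        (by linarith [hr.1]) hr.2).symm
    refine IsBigO.trans (IsBigO.of_bound 1 ?_)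
      ((h.proximity_logDeriv_isBigO hϱ hk hk0 hkT hs).add ih)
    filter_upwards [eventually_mem_Ico] with r hr
    rw [one_mul, Real.norm_of_nonneg (proximity_nonneg r)]
    refine le_trans ?_ (le_abs_self _)
    exact proximity_div_comp_le hk.deriv hk hf hk0 (by linarith [hr.1]) hr.2

end UnitDisc

theorem lemma3p3 (α β γ : ℝ → ℝ) (hαβγ : UnitDisc.Admissible α β γ)
    (f : ℂ → ℂ) (hf : MeromorphicOn f (Metric.ball 0 1))
    (hf0 : ∃ z ∈ Metric.ball (0 : ℂ) 1, meromorphicOrderAt f z ≠ ⊤)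
    (ϱ : ℝ) (hϱ : UnitDisc.logOrder α β γ f = (ϱ : EReal))
    (k : ℕ) (hk : 1 ≤ k) (ε : ℝ) (hε : 0 < ε) :
    ∃ F : Set ℝ, UnitDisc.FiniteLogMeasure F ∧
      (fun r : ℝ => ValueDistribution.proximity (fun z => iteratedDeriv k f z / f z) ⊤ r)
        =O[𝓝[Set.Ico 0 1 \ F] (1 : ℝ)]
      (fun r : ℝ => Real.exp
        (UnitDisc.inv α ((ϱ + ε) * β (Real.log (γ (1 / (1 - r))))))) := by
  have hϱ0 : 0 ≤ ϱ := by
    have := UnitDisc.logOrder_nonneg hαβγ f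
    rw [hϱ] at this
    exact_mod_cast this
  -- The estimate holds for all `r` near `1`, so no radii need to be removed.
  refine ⟨∅, ⟨empty_subset _, MeasurableSet.empty, by simp⟩, ?_⟩
  refine (hαβγ.proximity_iteratedDeriv_div_isBigO hϱ0 hf
    (fun s hs => hαβγ.posLog_characteristic_isBigO hϱ hs) (by linarith : ϱ < ϱ + ε) k).mono ?_
  exact nhdsWithin_mono _ fun r hr => hr.1.2
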